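/- **Setting.** Let $\{\nu_\theta : \theta\in\Theta\}$ be a one-parameter exponential family on $\mathbb R$, with densities $h(x)\exp\{\eta(x)\theta-A(\theta)\}$ with respect to a dominating measure, where $\Theta\subseteq\mathbb R$ is a nonempty open interval (possibly $\mathbb R$) on which the normalisation $A(\theta)$ is finite. Assume that the members have a mean and that the mean determines the natural parameter (for $\eta(x)=x$ and non-degenerate members this is automatic). Let $\mathcal M\subset\mathbb R$ be the set of means, and for $x,y\in\mathcal M$ let $d(x,y)$ be the Kullback–Leibler divergence from the member with mean $x$ to the member with mean $y$. Fix $\gamma\in\mathcal M$ and $K\ge 2$. A vector $\boldsymbol\lambda\in\mathcal M^K$ is called *feasible* if $\gamma\in\mathrm{Conv}\{\lambda_1,\dots,\lambda_K\}$ and *infeasible* otherwise. It is a *problem instance* if $\lambda_a\ne\gamma$ for all $a$ and the arm with the smallest mean and the arm with the largest mean are unique. A *strategy* chooses in each round an arm (possibly at random) on the basis of the past arms and rewards, and then observes an independent reward from that arm's distribution; it has a stopping time $\tau$ with respect to the filtration $(\mathcal F_t)$ of the observed arms and rewards, and an $\mathcal F_\tau$-measurable decision in $\{\text{feasible},\text{infeasible}\}$.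 For $\delta\in(0,1)$ it is *$\delta$-correct* if on every problem instance it stops almost surely and its decision is right with probability at least $1-\delta$. With $\Delta$ the probability simplex in $\mathbb R^K$ and $\mathrm{Alt}(\boldsymbol\mu)$ the set of all $\boldsymbol\lambda\in\mathcal M^K$ that are infeasible if $\boldsymbol\mu$ is feasible, and feasible if $\boldsymbol\mu$ is infeasible, put $$T^*(\boldsymbol\mu)^{-1}=\sup_{w\in\Delta}\ \inf_{\boldsymbol\lambda\in\mathrm{Alt}(\boldsymbol\mu)}\ \sum_{a=1}^K w_a\,d(\mu_a,\lambda_a),$$ and call $w\in\Delta$ *optimal* if it attains the supremum. **Theorem 1.** Let $\boldsymbol\mu\in\mathcal M^K$ be a problem instance, labelled so that $\mu_1$ is the unique smallest and $\mu_K$ the unique largest mean. For every family of strategies $(S_\delta)_{\delta\in(0,1)}$ such that $S_\delta$ is $\delta$-correct, with stopping times $\tau_\delta$, $$\liminf_{\delta\to0}\frac{\mathbb E_{\boldsymbol\mu}[\tau_\delta]}{\ln(1/\delta)}\ \ge\ T^*(\boldsymbol\mu),$$ where $$T^*(\boldsymbol\mu)=\begin{cases}\dfrac1{d(\mu_1,\gamma)}+\dfrac1{d(\mu_K,\gamma)}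 & \gamma\in\mathrm{Conv}\{\boldsymbol\mu\},\\[2mm] \displaystyle\sum_{i=1}^K\frac1{d(\mu_i,\gamma)} & \gamma\notin\mathrm{Conv}\{\boldsymbol\mu\}.\end{cases}$$ Moreover there is exactly one optimal weight vector $w^*\in\Delta$, namely $$w^*_a=\begin{cases}\dfrac{1/d(\mu_a,\gamma)}{1/d(\mu_1,\gamma)+1/d(\mu_K,\gamma)}\,\mathbf 1_{\{a\in\{1,K\}\}} & \gamma\in\mathrm{Conv}\{\boldsymbol\mu\},\\[3mm] \dfrac{1/d(\mu_a,\gamma)}{\sum_{i=1}^K 1/d(\mu_i,\gamma)} & \gamma\notin\mathrm{Conv}\{\boldsymbol\mu\}.\end{cases}$$ -/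

import Mathlib

open MeasureTheory ProbabilityTheory Filter Topology
open scoped ENNReal

noncomputable section

namespace CHM

/-- A one-parameter exponential family of reward distributions on `ℝ`, with densities
`x ↦ h x * exp (η x * θ - A θ)`, where `θ` ranges over a nonempty open interval `Θ`.
* `base` is the measure `h(x) dx` (with respect to Lebesgue measure, a counting measure or any
  other dominating measure);
* `stat` is the function `η`;
* `param` is `Θ`; the choice `Θ = ℝ` is allowed;
* `A θ = log ∫ exp (η x * θ) h(x) dx` is the normalisation, which `Measure.tilted` contains.
The members have a mean, and the mean determines the natural parameter. For `η x = x` these two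
last properties are automatic, see `ExpFamily.canonical`. -/
structure ExpFamily where
  base : Measure ℝ
  base_ne_zero : base ≠ 0
  stat : ℝ → ℝ
  measurable_stat : Measurable stat
  param : Set ℝ
  param_nonempty : param.Nonempty
  isOpen_param : IsOpen param
  ordConnected_param : param.OrdConnected
  param_subset : param ⊆ integrableExpSet stat base
  integrable_reward : ∀ θ ∈ param, Integrable (fun x : ℝ => x) (base.tilted fun x => θ * stat x)
  mean_injOn : Set.InjOn (fun θ => ∫ x, x ∂(base.tilted fun x => θ * stat x)) param

namespace ExpFamily

/-- The case `η x = x`: any nonzero, non-degenerate base measure gives an exponential family on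
every nonempty open interval on which the normalisation is finite. -/
def canonical (base : Measure ℝ) (param : Set ℝ) (hne : param.Nonempty) (ho : IsOpen param)
    (hc : param.OrdConnected) (hs : param ⊆ integrableExpSet (fun x : ℝ => x) base)
    (hnd : ∀ c : ℝ, ¬ ∀ᵐ x ∂base, x = c) : ExpFamily where
  base := base
  base_ne_zero := by
    rintro rfl
    exact hnd 0 (by simp)
  stat := fun x => x
  measurable_stat := measurable_id
  param := param
  param_nonempty := hne
  isOpen_param := ho
  ordConnected_param := hc
  param_subset := hs
  integrable_reward := fun θ hθ => by
    have h : θ ∈ interior (integrableExpSet (fun x : ℝ => x) base) := interior_maximal hs ho hθ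
    exact memLp_one_iff_integrable.1 (by simpa using memLp_tilted_mul h 1)
  mean_injOn := by
    have hint : ∀ θ ∈ param, θ ∈ interior (integrableExpSet (fun x : ℝ => x) base) :=
      fun θ hθ => interior_maximal hs ho hθ
    have hmean : ∀ θ ∈ param, ∫ x, x ∂(base.tilted fun x => θ * x)
        = deriv (cgf (fun x : ℝ => x) base) θ := fun θ hθ => integral_tilted_mul_self (hint θ hθ)
    have hmono : StrictMonoOn (deriv (cgf (fun x : ℝ => x) base)) param := by
      refine strictMonoOn_of_deriv_pos hc.convex ?_ ?_
      · intro θ hθ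
        exact (analyticAt_cgf (hint θ hθ)).deriv.continuousAt.continuousWithinAt
      · intro θ hθ
        have hθ' := hint θ (interior_subset hθ)
        have hv : Var[fun x : ℝ => x; base.tilted fun x => θ * x]
            = deriv (deriv (cgf (fun x : ℝ => x) base)) θ := by
          rw [variance_tilted_mul hθ', iteratedDeriv_succ, iteratedDeriv_one]
        rw [← hv]
        refine lt_of_le_of_ne (variance_nonneg _ _) fun h0 => ?_
        have hL : MemLp (fun x : ℝ => x) 2 (base.tilted fun x => θ * x) := memLp_tilted_mul hθ' 2
        have he : evariance (fun x : ℝ => x) (base.tilted fun x => θ * x) = 0 := by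
          have hb : NeZero base := ⟨by rintro rfl; exact hnd 0 (by simp)⟩
          have := isProbabilityMeasure_tilted (hs (interior_subset hθ))
          rw [← hL.ofReal_variance_eq, ← h0, ENNReal.ofReal_zero]
        rw [evariance_eq_zero_iff (by fun_prop)] at he
        exact hnd _ ((absolutelyContinuous_tilted (hs (interior_subset hθ))).ae_le he)
    intro a ha b hb hab
    simp only [hmean a ha, hmean b hb] at hab
    exact hmono.injOn ha hb hab

variable (F : ExpFamily)

/-- The mean of the member of the family with natural parameter `θ`. -/
def mean (θ : ℝ) : ℝ := ∫ x, x ∂(F.base.tilted fun x => θ * F.stat x)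

/-- The set of means of the members of the family. -/
def means : Set ℝ := F.mean '' F.param

/-- The natural parameter of the member of the family with mean `x`. -/
def natParam (x : F.means) : ℝ := x.2.choose

lemma natParam_mem (x : F.means) : F.natParam x ∈ F.param := x.2.choose_spec.1

lemma mean_natParam (x : F.means) : F.mean (F.natParam x) = x := x.2.choose_spec.2

/-- The member of the family with mean `x`. -/
def dist (x : F.means) : Measure ℝ := F.base.tilted fun y => F.natParam x * F.stat y

instance (x : F.means) : IsProbabilityMeasure (F.dist x) :=
  have : NeZero F.base := ⟨F.base_ne_zero⟩
  isProbabilityMeasure_tilted (F.param_subset (F.natParam_mem x))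

/-- `d(x, y)`: the Kullback-Leibler divergence between the members with means `x` and `y`. -/
def d (x y : F.means) : ℝ≥0∞ := InformationTheory.klDiv (F.dist x) (F.dist y)

end ExpFamily

/-- Infinite sequences of (arm, reward) pairs; index `i` is the `(i + 1)`-st round. -/
abbrev Traj (K : ℕ) : Type := ℕ → Fin K × ℝ

/-- The `σ`-algebra at time `n` is generated by the first `n` (arm, reward) pairs. -/
def hist (K : ℕ) : Filtration ℕ (inferInstance : MeasurableSpace (Traj K)) where
  seq n := MeasurableSpace.comap (fun (ω : Traj K) (i : Fin n) => ω i) inferInstance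
  mono' := by
    intro m n hmn
    have h : Measurable fun (f : Fin n → Fin K × ℝ) (i : Fin m) => f (Fin.castLE hmn i) := by
      fun_prop
    have := MeasurableSpace.comap_mono (g := fun (ω : Traj K) (i : Fin n) => ω i) h.comap_le
    rwa [MeasurableSpace.comap_comp] at this
  le' n := Measurable.comap_le (by fun_prop)

/-- A sequential testing strategy with `K` arms: a (possibly randomised) choice of the next arm
given the past, a stopping time (the number of samples taken, `⊤` if the strategy never stops),
and a decision (`true` for feasible, `false` for infeasible) that is measurable with respect to
the past at the stopping time. -/
structure Strategy (K : ℕ) where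
  policy : (n : ℕ) → Kernel (Fin n → Fin K × ℝ) (Fin K)
  isMarkov_policy : ∀ n, IsMarkovKernel (policy n)
  τ : Traj K → ℕ∞
  isStoppingTime : IsStoppingTime (hist K) τ
  decision : Traj K → Bool
  measurable_decision : Measurable[isStoppingTime.measurableSpace] decision

namespace Strategy

variable {K : ℕ} (S : Strategy K)

instance (n : ℕ) : IsMarkovKernel (S.policy n) := S.isMarkov_policy n

/-- The rewards as a kernel: pulling arm `a` gives a sample of `ν a`. -/
def reward (ν : Fin K → Measure ℝ) : Kernel (Fin K) ℝ := Kernel.ofFunOfCountable ν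

instance (ν : Fin K → Measure ℝ) [h : ∀ a, IsProbabilityMeasure (ν a)] :
    IsMarkovKernel (reward ν) := ⟨h⟩

/-- One round: given the past, draw the arm from the policy and, given the arm, draw the reward
from its distribution. -/
def step (ν : Fin K → Measure ℝ) (n : ℕ) : Kernel (Fin n → Fin K × ℝ) (Fin K × ℝ) :=
  S.policy n ⊗ₖ Kernel.prodMkLeft _ (reward ν)

instance (ν : Fin K → Measure ℝ) [∀ a, IsProbabilityMeasure (ν a)] (n : ℕ) :
    IsMarkovKernel (S.step ν n) := by
  unfold step; infer_instance

/-- A history indexed by `{0, …, n}` as a history indexed by `Fin (n + 1)`. -/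
def toFin (K n : ℕ) (f : Finset.Iic n → Fin K × ℝ) (i : Fin (n + 1)) : Fin K × ℝ :=
  f ⟨i, Finset.mem_Iic.2 (Nat.lt_succ_iff.1 i.2)⟩

lemma measurable_toFin (K n : ℕ) : Measurable (toFin K n) := by
  unfold toFin; fun_prop

/-- The law of the whole sequence of (arm, reward) pairs when arm `a` has reward law `ν a`. -/
def law (ν : Fin K → Measure ℝ) [∀ a, IsProbabilityMeasure (ν a)] : Measure (Traj K) :=
  Kernel.trajMeasure (X := fun _ => Fin K × ℝ) (S.step ν 0 Fin.elim0)
    fun n => (S.step ν (n + 1)).comap (toFin K n) (measurable_toFin K n)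

end Strategy

namespace ExpFamily

variable (F : ExpFamily) {K : ℕ}

/-- `γ` lies in the convex hull of the means `lam`. -/
def Feasible (γ : F.means) (lam : Fin K → F.means) : Prop :=
  (γ : ℝ) ∈ convexHull ℝ (Set.range fun a => (lam a : ℝ))

/-- The problem instances: the threshold is not one of the means, and the arm with the smallest
mean and the arm with the largest mean are unique. -/
def IsInstance (γ : F.means) (lam : Fin K → F.means) : Prop :=
  (∀ a, lam a ≠ γ) ∧ (∃ lo, ∀ a, a ≠ lo → lam lo < lam a) ∧ ∃ hi, ∀ a, a ≠ hi → lam a < lam hi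

/-- The law of the (arm, reward) pairs under the strategy `S` when the arms have means `lam`. -/
def banditLaw (S : Strategy K) (lam : Fin K → F.means) : Measure (Traj K) :=
  S.law fun a => F.dist (lam a)

/-- The expected number of samples `E[τ]`. -/
def expectedTime (S : Strategy K) (lam : Fin K → F.means) : ℝ≥0∞ :=
  ∫⁻ ω, (S.τ ω : ℝ≥0∞) ∂F.banditLaw S lam

/-- `δ`-correctness: on every problem instance the strategy stops almost surely and its decision
is right with probability at least `1 - δ`. -/
def IsDeltaCorrect (γ : F.means) (δ : ℝ) (S : Strategy K) : Prop :=
  ∀ lam : Fin K → F.means, F.IsInstance γ lam →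
    (∀ᵐ ω ∂F.banditLaw S lam, S.τ ω ≠ ⊤) ∧
    (F.Feasible γ lam →
      ENNReal.ofReal (1 - δ) ≤ F.banditLaw S lam {ω | S.decision ω = true}) ∧
    (¬ F.Feasible γ lam →
      ENNReal.ofReal (1 - δ) ≤ F.banditLaw S lam {ω | S.decision ω = false})

/-- The vectors of means for which the right answer differs from the one for `μ`. -/
def Alt (γ : F.means) (μ : Fin K → F.means) : Set (Fin K → F.means) :=
  {lam | ¬ (F.Feasible γ lam ↔ F.Feasible γ μ)}

/-- The information `inf_{lam ∈ Alt μ} ∑ a, w a * d (μ a) (lam a)` gathered by the weights `w`. -/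
def info (γ : F.means) (μ : Fin K → F.means) (w : Fin K → ℝ) : ℝ≥0∞ :=
  ⨅ lam ∈ F.Alt γ μ, ∑ a, ENNReal.ofReal (w a) * F.d (μ a) (lam a)

/-- The characteristic time `T*(μ)`, the inverse of the value of the pure exploration game. -/
def charTime (γ : F.means) (μ : Fin K → F.means) : ℝ≥0∞ :=
  (⨆ w ∈ stdSimplex ℝ (Fin K), F.info γ μ w)⁻¹

/-- `w` is an optimal vector of sampling proportions in the pure exploration game. -/
def IsOptimalWeights (γ : F.means) (μ : Fin K → F.means) (w : Fin K → ℝ) : Prop :=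
  w ∈ stdSimplex ℝ (Fin K) ∧ ∀ v ∈ stdSimplex ℝ (Fin K), F.info γ μ v ≤ F.info γ μ w

end ExpFamily

end CHM

end

/-! The lower bound is a change of measure. If `lam` is an instance with the other answer, a
δ-correct strategy gives the right answer for `μ` with probability at least 1 - δ under `μ`, but at
most δ under `lam`. Hence the log-likelihood ratio collected before stopping must be large on
average. Wald's identity at truncated times turns this into b ≤ ∑ n_a d(μ_a, λ_a), where b = (1 - δ)
ln(1/δ) - ln 2 and n_a is the expected number of pulls of arm a (`ofReal_le_sum_pulls_mul_d`). The
n_a add up to the expected stopping time.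

What remains is a deterministic question about nonnegative vectors n that satisfy this inequality
for all alternative instances. It is used twice: with n the expected pulls it bounds the stopping
time, and with n a weight vector it bounds the value of the game and yields uniqueness. Since d(x,
·) is continuous and increases away from x, bringing an arm to the other side of γ costs d(μ_a, γ),
up to an arbitrarily small error (`le_sum_mul_moveCost`).

If `μ` is feasible, the binding alternatives lift all arms below γ, or lower all arms above it. In
each group the extreme arm has the largest divergence, so the group must carry mass at least b /
d(extreme, γ) (`mul_le_sum_of_feasible`). If `μ` is infeasible, all arms lie on one side and moving
a single one is enough, so n_a ≥ b / d(μ_a, γ) for every a (`le_mul_of_not_feasible`).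

Conversely, put weights proportional to 1/d(μ_a, γ) on the relevant arms. Every alternative takes
one of these arms to γ or beyond, which costs at least 1/T. Weights add up to 1, so an optimal
vector has equality in all the bounds, and this determines it. -/

namespace CHM

/-! ### Bregman divergences of a function with strictly increasing derivative. -/

/-- The Bregman divergence of `A`, as a function of the parameters. -/
noncomputable def bregman (A : ℝ → ℝ) (u v : ℝ) : ℝ := A v - A u - (v - u) * deriv A u

section Bregman

variable {A : ℝ → ℝ} {s : Set ℝ}

lemma exists_deriv_mul_eq_sub (hs : s.OrdConnected) (hd : ∀ t ∈ s, DifferentiableAt ℝ A t)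
    {a b : ℝ} (ha : a ∈ s) (hb : b ∈ s) (hab : a < b) :
    ∃ ξ ∈ Set.Ioo a b, ξ ∈ s ∧ A b - A a = (b - a) * deriv A ξ := by
  have hsub : Set.Icc a b ⊆ s := hs.out ha hb
  obtain ⟨ξ, hξ, h⟩ := exists_deriv_eq_slope A hab
    (fun t ht => (hd t (hsub ht)).continuousAt.continuousWithinAt)
    (fun t ht => (hd t (hsub (Set.Ioo_subset_Icc_self ht))).differentiableWithinAt)
  refine ⟨ξ, hξ, hsub (Set.Ioo_subset_Icc_self hξ), ?_⟩
  rw [h]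
  have : b - a ≠ 0 := (sub_pos.2 hab).ne'
  field_simp

/-- By the mean value theorem `A` grows from `a` to `b` at a slope `deriv A ξ` with ξ > u, which
exceeds the slope of the tangent at `u`. -/
lemma bregman_lt_of_le_of_lt (hs : s.OrdConnected) (hd : ∀ t ∈ s, DifferentiableAt ℝ A t)
    (hm : StrictMonoOn (deriv A) s) {u a b : ℝ} (hu : u ∈ s) (ha : a ∈ s) (hb : b ∈ s)
    (hua : u ≤ a) (hab : a < b) : bregman A u a < bregman A u b := by
  obtain ⟨ξ, hξ, hξs, h⟩ := exists_deriv_mul_eq_sub hs hd ha hb hab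
  have h1 : deriv A u < deriv A ξ := hm hu hξs (hua.trans_lt hξ.1)
  have := mul_lt_mul_of_pos_left h1 (sub_pos.2 hab)
  unfold bregman
  nlinarith

lemma bregman_lt_of_lt_of_le (hs : s.OrdConnected) (hd : ∀ t ∈ s, DifferentiableAt ℝ A t)
    (hm : StrictMonoOn (deriv A) s) {u a b : ℝ} (hu : u ∈ s) (ha : a ∈ s) (hb : b ∈ s)
    (hua : a ≤ u) (hab : b < a) : bregman A u a < bregman A u b := by
  obtain ⟨ξ, hξ, hξs, h⟩ := exists_deriv_mul_eq_sub hs hd hb ha hab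
  have h1 : deriv A ξ < deriv A u := hm hξs hu (hξ.2.trans_le hua)
  have := mul_lt_mul_of_pos_left h1 (sub_pos.2 hab)
  unfold bregman
  nlinarith

/-- Three-point identity: B(u, v) - B(a, v) = B(u, a) + (v - a)(A'(a) - A'(u)), and both terms on
the right are positive. -/
lemma bregman_left_lt_of_lt_of_lt (hs : s.OrdConnected) (hd : ∀ t ∈ s, DifferentiableAt ℝ A t)
    (hm : StrictMonoOn (deriv A) s) {u a v : ℝ} (hu : u ∈ s) (ha : a ∈ s)
    (hua : u < a) (hav : a < v) : bregman A a v < bregman A u v := by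
  have h1 := bregman_lt_of_le_of_lt hs hd hm hu hu ha le_rfl hua
  have h2 := mul_lt_mul_of_pos_left (hm hu ha hua) (sub_pos.2 hav)
  unfold bregman at *
  nlinarith

lemma bregman_left_lt_of_gt_of_gt (hs : s.OrdConnected) (hd : ∀ t ∈ s, DifferentiableAt ℝ A t)
    (hm : StrictMonoOn (deriv A) s) {u a v : ℝ} (hu : u ∈ s) (ha : a ∈ s)
    (hua : a < u) (hav : v < a) : bregman A a v < bregman A u v := by
  have h1 := bregman_lt_of_lt_of_le hs hd hm hu hu ha le_rfl hua
  have h2 := mul_lt_mul_of_pos_left (hm ha hu hua) (sub_pos.2 hav)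
  unfold bregman at *
  nlinarith

end Bregman

/-! ### The divergence within the exponential family: order, densities, monotonicity, continuity. -/

namespace ExpFamily

variable (F : ExpFamily)

/-- The normalisation `A` of the family, as a function of the natural parameter. -/
noncomputable def normalisation : ℝ → ℝ := cgf F.stat F.base

instance : NeZero F.base := ⟨F.base_ne_zero⟩

variable {F} in
lemma mem_interior {θ : ℝ} (hθ : θ ∈ F.param) :
    θ ∈ interior (integrableExpSet F.stat F.base) :=
  interior_maximal F.param_subset F.isOpen_param hθ

variable {F} in
lemma integrable_exp {θ : ℝ} (hθ : θ ∈ F.param) :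
    Integrable (fun x => Real.exp (θ * F.stat x)) F.base := F.param_subset hθ

lemma differentiableAt_normalisation {θ : ℝ} (hθ : θ ∈ F.param) :
    DifferentiableAt ℝ F.normalisation θ :=
  (analyticAt_cgf (mem_interior hθ)).differentiableAt

lemma exists_Icc_subset_param {θ : ℝ} (hθ : θ ∈ F.param) :
    ∃ r > 0, Set.Icc (θ - r) (θ + r) ⊆ F.param := by
  obtain ⟨r, hr, h⟩ := Metric.nhds_basis_closedBall.mem_iff.1 (F.isOpen_param.mem_nhds hθ)
  exact ⟨r, hr, by rwa [Real.closedBall_eq_Icc] at h⟩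

/-- With an a.e. constant statistic the normalisation would cancel every tilt. All members would
coincide, although the mean is injective on an open interval of parameters. -/
lemma not_ae_eq_const (c : ℝ) : ¬ ∀ᵐ x ∂F.base, F.stat x = c := by
  intro h
  obtain ⟨θ, hθ⟩ := F.param_nonempty
  obtain ⟨r, hr, hsub⟩ := F.exists_Icc_subset_param hθ
  have hθ' : θ + r ∈ F.param := hsub ⟨by linarith, le_rfl⟩
  have key : ∀ t, F.base.tilted (fun x => t * F.stat x) = F.base.tilted (fun _ => 0) := by
    intro t
    have h1 : F.base.tilted (fun x => t * F.stat x) = F.base.tilted (fun _ => t * c) :=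
      tilted_congr (h.mono fun x hx => by simp only [hx])
    rw [h1, tilted_const', tilted_const']
  have := F.mean_injOn hθ hθ' (by simp only [key])
  linarith

/-- The second derivative of the normalisation is the variance of the statistic, which is positive
because the statistic is not a.e. constant. -/
lemma strictMonoOn_deriv_normalisation : StrictMonoOn (deriv F.normalisation) F.param := by
  refine strictMonoOn_of_deriv_pos F.ordConnected_param.convex ?_ ?_
  · intro θ hθ
    exact (analyticAt_cgf (mem_interior hθ)).deriv.continuousAt.continuousWithinAt
  · intro θ hθ
    have hθ' := mem_interior (interior_subset hθ)
    have hv : Var[F.stat; F.base.tilted fun x => θ * F.stat x]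
        = deriv (deriv F.normalisation) θ := by
      rw [variance_tilted_mul hθ', iteratedDeriv_succ, iteratedDeriv_one, normalisation]
    rw [← hv]
    refine lt_of_le_of_ne (variance_nonneg _ _) fun h0 => ?_
    have hL : MemLp F.stat 2 (F.base.tilted fun x => θ * F.stat x) := memLp_tilted_mul hθ' 2
    have he : evariance F.stat (F.base.tilted fun x => θ * F.stat x) = 0 := by
      have := isProbabilityMeasure_tilted (integrable_exp (interior_subset hθ))
      rw [← hL.ofReal_variance_eq, ← h0, ENNReal.ofReal_zero]
    rw [evariance_eq_zero_iff F.measurable_stat.aemeasurable] at he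
    exact F.not_ae_eq_const _
      ((absolutelyContinuous_tilted (integrable_exp (interior_subset hθ))).ae_le he)

/-- For a general statistic the mean reward is not the derivative of the normalisation, so
continuity comes from dominated convergence. Depending on the sign of the statistic, the exponential
at t ∈ [θ - r, θ + r] is dominated by the one at θ + r or at θ - r. -/
lemma continuousOn_mean : ContinuousOn F.mean F.param := by
  intro θ hθ
  obtain ⟨r, hr, hsub⟩ := F.exists_Icc_subset_param hθ
  have hl : θ - r ∈ F.param := hsub ⟨le_rfl, by linarith⟩
  have hu : θ + r ∈ F.param := hsub ⟨by linarith, le_rfl⟩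
  have heq : F.mean = fun t =>
      (∫ x, Real.exp (t * F.stat x) * x ∂F.base) / mgf F.stat F.base t := by
    funext t
    rw [mean, integral_tilted_mul_eq_mgf, ← integral_div]
    congr 1 with x
    rw [smul_eq_mul]
    ring
  have hi : ∀ t ∈ F.param, Integrable (fun x => Real.exp (t * F.stat x) * x) F.base :=
    fun t ht => (integrable_tilted_iff (integrable_exp ht) _).1 (F.integrable_reward t ht)
  have hm := F.measurable_stat
  have hnum : ContinuousAt (fun t => ∫ x, Real.exp (t * F.stat x) * x ∂F.base) θ := by
    refine continuousAt_of_dominated (bound := fun x =>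
      ‖Real.exp ((θ - r) * F.stat x) * x‖ + ‖Real.exp ((θ + r) * F.stat x) * x‖) ?_ ?_ ?_ ?_
    · exact Eventually.of_forall fun t => by
        have : Measurable fun x => Real.exp (t * F.stat x) * x := by fun_prop
        exact this.aestronglyMeasurable
    · filter_upwards [Icc_mem_nhds (show θ - r < θ by linarith) (show θ < θ + r by linarith)]
        with t ht
      refine Eventually.of_forall fun x => ?_
      simp only [norm_mul, Real.norm_eq_abs, Real.abs_exp, ← add_mul]
      refine mul_le_mul_of_nonneg_right ?_ (abs_nonneg _)
      rcases le_total 0 (F.stat x) with h | h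
      · have := Real.exp_le_exp.2 (mul_le_mul_of_nonneg_right ht.2 h)
        have := Real.exp_pos ((θ - r) * F.stat x)
        linarith
      · have := Real.exp_le_exp.2 (mul_le_mul_of_nonpos_right ht.1 h)
        have := Real.exp_pos ((θ + r) * F.stat x)
        linarith
    · exact (hi _ hl).norm.add (hi _ hu).norm
    · exact Eventually.of_forall fun x => by fun_prop
  have hden : ContinuousAt (mgf F.stat F.base) θ :=
    (differentiableAt_mgf (mem_interior hθ)).continuousAt
  rw [heq]
  exact (hnum.div hden (mgf_pos' F.base_ne_zero (integrable_exp hθ)).ne').continuousWithinAt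

lemma strictMonoOn_or_strictAntiOn_mean :
    StrictMonoOn F.mean F.param ∨ StrictAntiOn F.mean F.param := by
  have : Inhabited F.param := Classical.inhabited_of_nonempty F.param_nonempty.to_subtype
  have := F.ordConnected_param
  have hc : Continuous (F.param.domRestrict F.mean) := F.continuousOn_mean.domRestrict
  have hi : Function.Injective (F.param.domRestrict F.mean) := F.mean_injOn.injective
  exact (hc.strictMono_of_inj hi).imp strictMono_domRestrict.mp Set.strictAntiOn_iff_strictAnti.mpr

/-- This makes `F.means` densely ordered, so that nonempty open intervals of means are infinite. -/
instance : F.means.OrdConnected := by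
  refine (IsPreconnected.image ?_ _ F.continuousOn_mean).ordConnected
  exact F.ordConnected_param.isPreconnected

/-- The mean may decrease in the natural parameter, for instance when η(x) = -x. Order arguments
about means therefore come in two mirror-image cases. -/
lemma natParam_lt_or :
    (∀ x y : F.means, x < y ↔ F.natParam x < F.natParam y) ∨
      ∀ x y : F.means, x < y ↔ F.natParam y < F.natParam x := by
  refine F.strictMonoOn_or_strictAntiOn_mean.imp (fun h x y => ?_) fun h x y => ?_
  · rw [← h.lt_iff_lt (F.natParam_mem x) (F.natParam_mem y), F.mean_natParam, F.mean_natParam,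
      Subtype.coe_lt_coe]
  · rw [← h.lt_iff_gt (F.natParam_mem x) (F.natParam_mem y), F.mean_natParam, F.mean_natParam,
      Subtype.coe_lt_coe]

variable {F}

lemma natParam_mean {θ : ℝ} (hθ : θ ∈ F.param) (h : F.mean θ ∈ F.means) :
    F.natParam ⟨F.mean θ, h⟩ = θ :=
  F.mean_injOn (F.natParam_mem _) hθ (F.mean_natParam _)

/-- The logarithm of the density of `F.dist x` with respect to `F.dist y`. -/
noncomputable def logRatio (x y : F.means) (z : ℝ) : ℝ :=
  (F.natParam x - F.natParam y) * F.stat z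
    - (F.normalisation (F.natParam x) - F.normalisation (F.natParam y))

lemma measurable_logRatio (x y : F.means) : Measurable (logRatio x y) := by
  have := F.measurable_stat
  unfold logRatio
  fun_prop

lemma dist_eq_tilted (x y : F.means) :
    F.dist y = (F.dist x).tilted fun z => (F.natParam y - F.natParam x) * F.stat z := by
  rw [dist, dist, tilted_tilted (integrable_exp (F.natParam_mem x))]
  congr 1 with z
  simp only [Pi.add_apply]
  ring

lemma integrable_exp_sub_dist (x y : F.means) :
    Integrable (fun z => Real.exp ((F.natParam y - F.natParam x) * F.stat z)) (F.dist x) := by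
  rw [dist, integrable_tilted_iff (integrable_exp (F.natParam_mem x))]
  refine (integrable_exp (F.natParam_mem y)).congr (Eventually.of_forall fun z => ?_)
  simp only [smul_eq_mul, ← Real.exp_add]
  ring_nf

lemma integral_exp_sub_dist (x y : F.means) :
    ∫ z, Real.exp ((F.natParam y - F.natParam x) * F.stat z) ∂(F.dist x)
      = Real.exp (F.normalisation (F.natParam y) - F.normalisation (F.natParam x)) := by
  rw [dist, integral_exp_tilted, Real.exp_sub, normalisation,
    exp_cgf (integrable_exp (F.natParam_mem x)), exp_cgf (integrable_exp (F.natParam_mem y)),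
    mgf, mgf]
  congr 2 with z
  simp only [Pi.add_apply]
  ring_nf

lemma dist_eq_withDensity (x y : F.means) :
    F.dist y = (F.dist x).withDensity fun z => ENNReal.ofReal (Real.exp (-logRatio x y z)) := by
  rw [dist_eq_tilted x y, Measure.tilted, integral_exp_sub_dist]
  congr 1 with z
  rw [← Real.exp_sub, logRatio]
  ring_nf

lemma llr_dist (x y : F.means) : llr (F.dist x) (F.dist y) =ᵐ[F.dist x] logRatio x y := by
  have h := llr_tilted_right (Measure.AbsolutelyContinuous.refl (F.dist x))
    (integrable_exp_sub_dist x y)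
  rw [← dist_eq_tilted x y, integral_exp_sub_dist, Real.log_exp] at h
  filter_upwards [h, llr_self (F.dist x)] with z hz h0
  rw [hz, h0, logRatio, Pi.zero_apply]
  ring

lemma integrable_stat (x : F.means) : Integrable F.stat (F.dist x) :=
  memLp_one_iff_integrable.1 (memLp_tilted_mul (mem_interior (F.natParam_mem x)) 1)

lemma integrable_logRatio (x y : F.means) : Integrable (logRatio x y) (F.dist x) :=
  ((integrable_stat x).const_mul _).sub (integrable_const _)

lemma integral_logRatio (x y : F.means) :
    ∫ z, logRatio x y z ∂(F.dist x) = bregman F.normalisation (F.natParam x) (F.natParam y) := by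
  have h : ∫ z, F.stat z ∂(F.dist x) = deriv F.normalisation (F.natParam x) :=
    integral_tilted_mul_self (mem_interior (F.natParam_mem x))
  unfold logRatio
  rw [integral_sub ((integrable_stat x).const_mul _) (integrable_const _), integral_const_mul, h,
    bregman]
  simp
  ring

lemma absolutelyContinuous_dist (x y : F.means) : F.dist x ≪ F.dist y :=
  (tilted_absolutelyContinuous _ _).trans
    (absolutelyContinuous_tilted (integrable_exp (F.natParam_mem y)))

lemma d_ne_top (x y : F.means) : F.d x y ≠ ∞ :=
  InformationTheory.klDiv_ne_top (absolutelyContinuous_dist x y)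
    ((integrable_congr (llr_dist x y)).2 (integrable_logRatio x y))

lemma toReal_d_eq_integral (x y : F.means) :
    (F.d x y).toReal = ∫ z, logRatio x y z ∂(F.dist x) := by
  rw [d, InformationTheory.toReal_klDiv_of_measure_eq (absolutelyContinuous_dist x y) (by simp),
    integral_congr_ae (llr_dist x y)]

lemma toReal_d (x y : F.means) :
    (F.d x y).toReal = bregman F.normalisation (F.natParam x) (F.natParam y) := by
  rw [toReal_d_eq_integral, integral_logRatio]

lemma d_self (x : F.means) : F.d x x = 0 := InformationTheory.klDiv_self _

lemma d_lt_d_iff (x y x' y' : F.means) : F.d x y < F.d x' y' ↔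
    bregman F.normalisation (F.natParam x) (F.natParam y)
      < bregman F.normalisation (F.natParam x') (F.natParam y') := by
  rw [← toReal_d, ← toReal_d, ENNReal.toReal_lt_toReal (d_ne_top _ _) (d_ne_top _ _)]

lemma d_right_lt_of_le_of_lt {x y z : F.means} (hxy : x ≤ y) (hyz : y < z) :
    F.d x y < F.d x z := by
  rw [d_lt_d_iff]
  rcases F.natParam_lt_or with h | h
  · exact bregman_lt_of_le_of_lt F.ordConnected_param
      (fun _ => F.differentiableAt_normalisation) F.strictMonoOn_deriv_normalisation
      (F.natParam_mem _) (F.natParam_mem _) (F.natParam_mem _)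
      (not_lt.1 fun hlt => hxy.not_gt ((h _ _).2 hlt)) ((h _ _).1 hyz)
  · exact bregman_lt_of_lt_of_le F.ordConnected_param
      (fun _ => F.differentiableAt_normalisation) F.strictMonoOn_deriv_normalisation
      (F.natParam_mem _) (F.natParam_mem _) (F.natParam_mem _)
      (not_lt.1 fun hlt => hxy.not_gt ((h _ _).2 hlt)) ((h _ _).1 hyz)

lemma d_right_lt_of_ge_of_gt {x y z : F.means} (hxy : y ≤ x) (hyz : z < y) :
    F.d x y < F.d x z := by
  rw [d_lt_d_iff]
  rcases F.natParam_lt_or with h | h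
  · exact bregman_lt_of_lt_of_le F.ordConnected_param
      (fun _ => F.differentiableAt_normalisation) F.strictMonoOn_deriv_normalisation
      (F.natParam_mem _) (F.natParam_mem _) (F.natParam_mem _)
      (not_lt.1 fun hlt => hxy.not_gt ((h _ _).2 hlt)) ((h _ _).1 hyz)
  · exact bregman_lt_of_le_of_lt F.ordConnected_param
      (fun _ => F.differentiableAt_normalisation) F.strictMonoOn_deriv_normalisation
      (F.natParam_mem _) (F.natParam_mem _) (F.natParam_mem _)
      (not_lt.1 fun hlt => hxy.not_gt ((h _ _).2 hlt)) ((h _ _).1 hyz)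

/-- With `z` the threshold, this says that among the arms on one side the extreme one has the
largest divergence. -/
lemma d_left_lt_of_lt_of_lt {x y z : F.means} (hxy : x < y) (hyz : y < z) :
    F.d y z < F.d x z := by
  rw [d_lt_d_iff]
  rcases F.natParam_lt_or with h | h
  · exact bregman_left_lt_of_lt_of_lt F.ordConnected_param
      (fun _ => F.differentiableAt_normalisation) F.strictMonoOn_deriv_normalisation
      (F.natParam_mem _) (F.natParam_mem _) ((h _ _).1 hxy) ((h _ _).1 hyz)
  · exact bregman_left_lt_of_gt_of_gt F.ordConnected_param
      (fun _ => F.differentiableAt_normalisation) F.strictMonoOn_deriv_normalisation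
      (F.natParam_mem _) (F.natParam_mem _) ((h _ _).1 hxy) ((h _ _).1 hyz)

lemma d_left_lt_of_gt_of_gt {x y z : F.means} (hxy : y < x) (hyz : z < y) :
    F.d y z < F.d x z := by
  rw [d_lt_d_iff]
  rcases F.natParam_lt_or with h | h
  · exact bregman_left_lt_of_gt_of_gt F.ordConnected_param
      (fun _ => F.differentiableAt_normalisation) F.strictMonoOn_deriv_normalisation
      (F.natParam_mem _) (F.natParam_mem _) ((h _ _).1 hxy) ((h _ _).1 hyz)
  · exact bregman_left_lt_of_lt_of_lt F.ordConnected_param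
      (fun _ => F.differentiableAt_normalisation) F.strictMonoOn_deriv_normalisation
      (F.natParam_mem _) (F.natParam_mem _) ((h _ _).1 hxy) ((h _ _).1 hyz)

lemma d_pos {x y : F.means} (h : x ≠ y) : 0 < F.d x y := by
  rw [← d_self x]
  rcases h.lt_or_gt with h | h
  · exact d_right_lt_of_le_of_lt le_rfl h
  · exact d_right_lt_of_ge_of_gt le_rfl h

/-- `d x` is continuous at `y`, with the neighbourhoods of `y` given by intervals of means. -/
lemma exists_Ioo_d_le (x y : F.means) {ε : ℝ≥0∞} (hε : 0 < ε) :
    ∃ l u : F.means, l < y ∧ y < u ∧ ∀ z, l < z → z < u → F.d x z ≤ F.d x y + ε := by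
  obtain ⟨r, hr, hsub⟩ := F.exists_Icc_subset_param (F.natParam_mem y)
  have hc : ContinuousAt (fun v => ENNReal.ofReal (bregman F.normalisation (F.natParam x) v))
      (F.natParam y) := by
    have := (F.differentiableAt_normalisation (F.natParam_mem y)).continuousAt
    refine ENNReal.continuous_ofReal.continuousAt.comp ?_
    unfold bregman
    fun_prop
  have hd : ∀ z, ENNReal.ofReal (bregman F.normalisation (F.natParam x) (F.natParam z))
      = F.d x z := fun z => by rw [← toReal_d, ENNReal.ofReal_toReal (d_ne_top _ _)]
  have hev := hc.eventually_le_const (u := F.d x y + ε) (by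
    simp only [hd]
    exact ENNReal.lt_add_right (d_ne_top _ _) hε.ne')
  obtain ⟨e, he, hball⟩ := Metric.eventually_nhds_iff.1 hev
  -- The bound `r` keeps both shifted parameters in the open parameter set, and `e / 2` keeps them
  -- inside the neighbourhood given by continuity.
  set q := min r (e / 2) with hq
  have hq0 : 0 < q := lt_min hr (half_pos he)
  have hqr : q ≤ r := min_le_left _ _
  have hqe : q < e := (min_le_right _ _).trans_lt (half_lt_self he)
  have h1 : F.natParam y - q ∈ F.param := hsub ⟨by linarith, by linarith⟩
  have h2 : F.natParam y + q ∈ F.param := hsub ⟨by linarith, by linarith⟩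
  let m1 : F.means := ⟨F.mean (F.natParam y - q), _, h1, rfl⟩
  let m2 : F.means := ⟨F.mean (F.natParam y + q), _, h2, rfl⟩
  have e1 : F.natParam m1 = F.natParam y - q := natParam_mean h1 _
  have e2 : F.natParam m2 = F.natParam y + q := natParam_mean h2 _
  have key : ∀ z, F.natParam m1 < F.natParam z → F.natParam z < F.natParam m2 →
      F.d x z ≤ F.d x y + ε := by
    intro z hz1 hz2
    rw [← hd z]
    refine hball ?_
    rw [Real.dist_eq, abs_lt]
    constructor <;> linarith
  rcases F.natParam_lt_or with h | h
  · exact ⟨m1, m2, (h _ _).2 (by linarith), (h _ _).2 (by linarith),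
      fun z hz1 hz2 => key z ((h _ _).1 hz1) ((h _ _).1 hz2)⟩
  · exact ⟨m2, m1, (h _ _).2 (by linarith), (h _ _).2 (by linarith),
      fun z hz1 hz2 => key z ((h _ _).1 hz2) ((h _ _).1 hz1)⟩

end ExpFamily

end CHM

/-! ### Alternative instances close to the threshold. -/

namespace CHM

namespace ExpFamily

variable {F : ExpFamily} {K : ℕ}

lemma feasible_iff (γ : F.means) (lam : Fin K → F.means) :
    F.Feasible γ lam ↔ (∃ a, lam a ≤ γ) ∧ ∃ b, γ ≤ lam b := by
  constructor
  · intro h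
    constructor
    · by_contra! hc
      have : convexHull ℝ (Set.range fun a => (lam a : ℝ)) ⊆ Set.Ioi (γ : ℝ) :=
        convexHull_min (by rintro _ ⟨a, rfl⟩; exact hc a) (convex_Ioi _)
      exact lt_irrefl _ (Set.mem_Ioi.1 (this h))
    · by_contra! hc
      have : convexHull ℝ (Set.range fun a => (lam a : ℝ)) ⊆ Set.Iio (γ : ℝ) :=
        convexHull_min (by rintro _ ⟨a, rfl⟩; exact hc a) (convex_Iio _)
      exact lt_irrefl _ (Set.mem_Iio.1 (this h))
  · rintro ⟨⟨a, ha⟩, b, hb⟩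
    have hab : (lam a : ℝ) ≤ lam b := ha.trans hb
    have h1 : (γ : ℝ) ∈ segment ℝ (lam a : ℝ) (lam b) := by
      rw [segment_eq_Icc hab]
      exact ⟨ha, hb⟩
    exact segment_subset_convexHull (Set.mem_range_self a) (Set.mem_range_self b) h1

lemma isInstance_of_injective [NeZero K] {γ : F.means} {lam : Fin K → F.means}
    (hi : Function.Injective lam) (hγ : ∀ a, lam a ≠ γ) : F.IsInstance γ lam := by
  refine ⟨hγ, ?_, ?_⟩
  · obtain ⟨lo, h⟩ := Finite.exists_min lam
    exact ⟨lo, fun a ha => lt_of_le_of_ne (h a) fun he => ha (hi he).symm⟩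
  · obtain ⟨hi', h⟩ := Finite.exists_max lam
    exact ⟨hi', fun a ha => lt_of_le_of_ne (h a) fun he => ha (hi he)⟩

/-- A system of distinct representatives of finitely many infinite sets. -/
lemma exists_injective_mem_of_infinite {α : Type*} (I : Fin K → Set α)
    (hI : ∀ a, (I a).Infinite) : ∃ f : Fin K → α, Function.Injective f ∧ ∀ a, f a ∈ I a := by
  classical
  choose t ht hcard using fun a => (hI a).exists_subset_card_eq K
  -- Hall's condition holds because a single index already contributes K elements, and no set of
  -- indices has more than K members.
  obtain ⟨f, hf, hft⟩ := (Finset.all_card_le_biUnion_card_iff_exists_injective t).1 (by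
    intro s
    rcases s.eq_empty_or_nonempty with rfl | ⟨a, ha⟩
    · simp
    · calc s.card ≤ K := by simpa using s.card_le_univ
        _ = (t a).card := (hcard a).symm
        _ ≤ _ := Finset.card_le_card (Finset.subset_biUnion_of_mem t ha))
  exact ⟨f, hf, fun a => ht a (hft a)⟩

/-- The infimal cost of moving the arm `a` to the side of `γ` that is prescribed by
the set `U` of the arms that have to lie above `γ`. -/
noncomputable def moveCost (γ : F.means) (μ : Fin K → F.means) (U : Finset (Fin K)) (a : Fin K) :
    ℝ≥0∞ :=
  if γ < μ a ↔ a ∈ U then 0 else F.d (μ a) γ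

lemma exists_injective_d_le_moveCost (γ : F.means) (μ : Fin K → F.means) (hγ : ∀ a, μ a ≠ γ)
    (U : Finset (Fin K)) {ε : ℝ≥0∞} (hε : 0 < ε) :
    ∃ lam : Fin K → F.means, Function.Injective lam ∧ (∀ a, lam a ≠ γ) ∧
      (∀ a, γ < lam a ↔ a ∈ U) ∧ ∀ a, F.d (μ a) (lam a) ≤ moveCost γ μ U a + ε := by
  -- Correctness is only known on instances, so the new means are chosen distinct and different from
  -- γ. An arm on its prescribed side stays near `μ a` and any other goes just across γ. Either way
  -- a whole interval of means is admissible.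
  obtain ⟨f, hf, h⟩ := exists_injective_mem_of_infinite
    (fun a => {z : F.means | z ≠ γ ∧ (γ < z ↔ a ∈ U) ∧ F.d (μ a) z ≤ moveCost γ μ U a + ε}) (by
      intro a
      by_cases hag : γ < μ a ↔ a ∈ U
      · obtain ⟨l, u, hl, hu, hlu⟩ := exists_Ioo_d_le (μ a) (μ a) hε
        rw [d_self] at hlu
        by_cases ha : a ∈ U
        · refine (Set.Ioo_infinite (max_lt hl (hag.2 ha))).mono fun z hz => ?_
          have h2 := (le_max_right _ _).trans_lt hz.1
          refine ⟨h2.ne', iff_of_true h2 ha, ?_⟩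
          rw [moveCost, if_pos hag]
          exact hlu z ((le_max_left _ _).trans_lt hz.1) (hz.2.trans hu)
        · have hlt : μ a < γ := lt_of_le_of_ne (not_lt.1 fun h => ha (hag.1 h)) (hγ a)
          refine (Set.Ioo_infinite (lt_min hu hlt)).mono fun z hz => ?_
          have h2 := hz.2.trans_le (min_le_right _ _)
          refine ⟨h2.ne, iff_of_false h2.not_gt ha, ?_⟩
          rw [moveCost, if_pos hag]
          exact hlu z (hl.trans hz.1) (hz.2.trans_le (min_le_left _ _))
      · obtain ⟨l, u, hl, hu, hlu⟩ := exists_Ioo_d_le (μ a) γ hε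
        by_cases ha : a ∈ U
        · refine (Set.Ioo_infinite hu).mono fun z hz => ⟨hz.1.ne', iff_of_true hz.1 ha, ?_⟩
          rw [moveCost, if_neg hag]
          exact hlu z (hl.trans hz.1) hz.2
        · refine (Set.Ioo_infinite hl).mono fun z hz => ⟨hz.2.ne, iff_of_false hz.2.not_gt ha, ?_⟩
          rw [moveCost, if_neg hag]
          exact hlu z hz.1 (hz.2.trans hu))
  exact ⟨f, hf, fun a => (h a).1, fun a => (h a).2.1, fun a => (h a).2.2⟩

/-- A lower bound on the information about all alternative problem instances passes to the limit,
where the arms are moved to the threshold. -/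
lemma le_sum_mul_moveCost [NeZero K] {γ : F.means} {μ : Fin K → F.means} (hγ : ∀ a, μ a ≠ γ)
    {n : Fin K → ℝ≥0∞} (hn : ∑ a, n a ≠ ∞) {b : ℝ≥0∞}
    (h : ∀ lam ∈ F.Alt γ μ, F.IsInstance γ lam → b ≤ ∑ a, n a * F.d (μ a) (lam a))
    {U : Finset (Fin K)} (hU : ¬ ((U.Nonempty ∧ U ≠ Finset.univ) ↔ F.Feasible γ μ)) :
    b ≤ ∑ a, n a * moveCost γ μ U a := by
  refine ENNReal.le_of_forall_pos_le_add fun ε hε _ => ?_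
  -- The error per unit of mass. The `+ 1` keeps the denominator nonzero, and finiteness of the
  -- total mass keeps the quotient positive.
  have hη : 0 < (ε : ℝ≥0∞) / (∑ a, n a + 1) :=
    ENNReal.div_pos (by exact_mod_cast hε.ne') (by finiteness)
  obtain ⟨lam, hinj, hne, hside, hd⟩ := exists_injective_d_le_moveCost γ μ hγ U hη
  have hfe : F.Feasible γ lam ↔ (U.Nonempty ∧ U ≠ Finset.univ) := by
    rw [feasible_iff, and_comm]
    refine and_congr ?_ ?_
    · refine exists_congr fun a => ?_
      rw [← hside a, le_iff_lt_or_eq]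
      exact or_iff_left (hne a).symm
    · rw [Ne, Finset.eq_univ_iff_forall, not_forall]
      refine exists_congr fun a => ?_
      rw [← hside a, not_lt]
  calc b ≤ ∑ a, n a * F.d (μ a) (lam a) :=
        h lam (by rw [Alt, Set.mem_ofPred_eq, hfe]; exact hU) (isInstance_of_injective hinj hne)
    _ ≤ ∑ a, n a * (moveCost γ μ U a + ε / (∑ a, n a + 1)) := by gcongr with a; exact hd a
    _ = ∑ a, n a * moveCost γ μ U a + (∑ a, n a) * (ε / (∑ a, n a + 1)) := by
        simp only [mul_add, Finset.sum_add_distrib, Finset.sum_mul]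
    _ ≤ ∑ a, n a * moveCost γ μ U a + ε := by
        gcongr
        calc (∑ a, n a) * (ε / (∑ a, n a + 1)) ≤ (∑ a, n a + 1) * (ε / (∑ a, n a + 1)) := by
              gcongr; exact le_self_add
          _ ≤ ε := ENNReal.mul_div_le

lemma d_le_d_of_cross {x y z : F.means} (h : x ≤ y ∧ y ≤ z ∨ y ≤ x ∧ z ≤ y) :
    F.d x y ≤ F.d x z := by
  rcases h with ⟨h1, h2⟩ | ⟨h1, h2⟩
  · rcases h2.eq_or_lt with rfl | h2
    · rfl
    · exact (d_right_lt_of_le_of_lt h1 h2).le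
  · rcases h2.eq_or_lt with rfl | h2
    · rfl
    · exact (d_right_lt_of_ge_of_gt h1 h2).le

lemma d_ne_zero {x y : F.means} (h : x ≠ y) : F.d x y ≠ 0 := (d_pos h).ne'

/-! ### Value and optimal weights of the exploration game. -/

section Game

/-- The value and the optimal weights of the exploration game, when the optimal weights are
supported on `s`: there the opponent has to move some arm of `s` across the threshold. -/
lemma charTime_eq_and_isOptimalWeights_iff {γ : F.means} {μ : Fin K → F.means}
    (hγ : ∀ a, μ a ≠ γ) {s : Finset (Fin K)} (hs : s.Nonempty)
    (hcross : ∀ lam ∈ F.Alt γ μ, ∃ a ∈ s, F.d (μ a) γ ≤ F.d (μ a) (lam a))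
    (hupper : ∀ w ∈ stdSimplex ℝ (Fin K), F.info γ μ w * ∑ a ∈ s, 1 / F.d (μ a) γ ≤ 1)
    (huniq : ∀ w ∈ stdSimplex ℝ (Fin K), (∑ a ∈ s, 1 / F.d (μ a) γ)⁻¹ ≤ F.info γ μ w →
      ∀ a, w a = if a ∈ s then (1 / F.d (μ a) γ / ∑ i ∈ s, 1 / F.d (μ i) γ).toReal else 0) :
    F.charTime γ μ = ∑ a ∈ s, 1 / F.d (μ a) γ ∧
      ∀ w : Fin K → ℝ, F.IsOptimalWeights γ μ w ↔
        ∀ a, w a = if a ∈ s then (1 / F.d (μ a) γ / ∑ i ∈ s, 1 / F.d (μ i) γ).toReal else 0 := by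
  set T := ∑ a ∈ s, 1 / F.d (μ a) γ with hT
  have hd0 : ∀ a, F.d (μ a) γ ≠ 0 := fun a => d_ne_zero (hγ a)
  have hdt : ∀ a, F.d (μ a) γ ≠ ∞ := fun a => d_ne_top _ _
  have hi0 : ∀ a, 1 / F.d (μ a) γ ≠ 0 := fun a => by simp [hdt a]
  have hit : ∀ a, 1 / F.d (μ a) γ ≠ ∞ := fun a => by simp [hd0 a]
  have hTt : T ≠ ∞ := by simp [hT, ENNReal.sum_eq_top, hd0]
  have hT0 : T ≠ 0 := by
    obtain ⟨a, ha⟩ := hs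
    intro h0
    exact hi0 a (Finset.sum_eq_zero_iff.1 h0 a ha)
  set ws : Fin K → ℝ := fun a => if a ∈ s then (1 / F.d (μ a) γ / T).toReal else 0 with hws
  have hmem : ws ∈ stdSimplex ℝ (Fin K) := by
    refine ⟨fun a => ?_, ?_⟩
    · simp only [hws]; split_ifs <;> positivity
    · simp only [hws, Finset.sum_ite_mem, Finset.univ_inter]
      rw [← ENNReal.toReal_sum fun a _ => ENNReal.div_ne_top (hit a) hT0]
      simp only [div_eq_mul_inv (_ / _) T]
      rw [← Finset.sum_mul, ← hT, ENNReal.mul_inv_cancel hT0 hTt, ENNReal.toReal_one]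
  -- For every arm of `s` the weight times d(μ_a, γ) equals 1/T, so crossing any one of them already
  -- costs 1/T.
  have hlow : T⁻¹ ≤ F.info γ μ ws := by
    refine le_iInf₂ fun lam hlam => ?_
    obtain ⟨a, has, ha⟩ := hcross lam hlam
    refine le_trans ?_ (Finset.single_le_sum
      (f := fun a => ENNReal.ofReal (ws a) * F.d (μ a) (lam a)) (fun _ _ => zero_le)
      (Finset.mem_univ a))
    simp only [hws, if_pos has]
    rw [ENNReal.ofReal_toReal (ENNReal.div_ne_top (hit a) hT0)]
    refine le_trans ?_ (mul_le_mul_right ha _)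
    rw [div_eq_mul_inv (_ / _) T, one_div, mul_right_comm, ENNReal.inv_mul_cancel (hd0 a) (hdt a),
      one_mul]
  have hup : ∀ w ∈ stdSimplex ℝ (Fin K), F.info γ μ w ≤ T⁻¹ := fun w hw =>
    ENNReal.le_inv_iff_mul_le.2 (hupper w hw)
  refine ⟨?_, fun w => ⟨fun hw => huniq w hw.1 (hlow.trans (hw.2 ws hmem)), fun hw => ?_⟩⟩
  · rw [charTime, le_antisymm (iSup₂_le hup) (hlow.trans (le_iSup₂_of_le ws hmem le_rfl)), inv_inv]
  · obtain rfl : w = ws := funext hw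
    exact ⟨hmem, fun v hv => (hup v hv).trans hlow⟩

lemma le_sum_div_of_le_sum_mul {ι : Type*} {s : Finset ι} {n D : ι → ℝ≥0∞} {b D₀ : ℝ≥0∞}
    (h : b ≤ ∑ a ∈ s, n a * D a) (hD : ∀ a ∈ s, D a ≤ D₀) (h0 : D₀ ≠ 0) (ht : D₀ ≠ ∞) :
    b * (1 / D₀) ≤ ∑ a ∈ s, n a := by
  rw [mul_one_div, ENNReal.div_le_iff h0 ht, Finset.sum_mul]
  exact h.trans (Finset.sum_le_sum fun a ha => by gcongr; exact hD a ha)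

/-- Equality case of replacing every `D a` by the largest value `D i`: the terms `w a * (D i - D a)`
are nonnegative and their sum is at most 0. -/
lemma eq_zero_of_le_sum_mul {ι : Type*} {s : Finset ι} {w D : ι → ℝ} {t : ℝ} {i : ι}
    (h : t ≤ ∑ a ∈ s, w a * D a) (hw : ∀ a, 0 ≤ w a) (hD : ∀ a ∈ s, a ≠ i → D a < D i)
    (hsum : (∑ a ∈ s, w a) * D i ≤ t) : ∀ a ∈ s, a ≠ i → w a = 0 := by
  have hnn : ∀ a ∈ s, 0 ≤ w a * (D i - D a) := fun a ha => by
    rcases eq_or_ne a i with rfl | hai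
    · simp
    · exact mul_nonneg (hw a) (sub_nonneg.2 (hD a ha hai).le)
  have h0 : ∑ a ∈ s, w a * (D i - D a) = 0 := by
    refine le_antisymm ?_ (Finset.sum_nonneg hnn)
    simp only [mul_sub, Finset.sum_sub_distrib, ← Finset.sum_mul]
    linarith
  intro a ha hai
  rcases mul_eq_zero.1 ((Finset.sum_eq_zero_iff_of_nonneg hnn).1 h0 a ha) with h | h
  · exact h
  · exact absurd h (sub_pos.2 (hD a ha hai)).ne'

lemma sum_mul_moveCost_univ (γ : F.means) (μ : Fin K → F.means) (n : Fin K → ℝ≥0∞) :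
    ∑ a, n a * moveCost γ μ Finset.univ a
      = ∑ a with ¬ γ < μ a, n a * F.d (μ a) γ := by
  rw [Finset.sum_filter]
  refine Finset.sum_congr rfl fun a _ => ?_
  simp only [moveCost, Finset.mem_univ, iff_true]
  split_ifs <;> simp_all

lemma sum_mul_moveCost_empty (γ : F.means) (μ : Fin K → F.means) (n : Fin K → ℝ≥0∞) :
    ∑ a, n a * moveCost γ μ ∅ a = ∑ a with γ < μ a, n a * F.d (μ a) γ := by
  rw [Finset.sum_filter]
  refine Finset.sum_congr rfl fun a _ => ?_
  simp only [moveCost, Finset.notMem_empty, iff_false]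
  split_ifs <;> simp_all

lemma le_info_of_le {γ : F.means} {μ : Fin K → F.means} {w : Fin K → ℝ} {b : ℝ≥0∞}
    (h : b ≤ F.info γ μ w) : ∀ lam ∈ F.Alt γ μ, F.IsInstance γ lam →
      b ≤ ∑ a, ENNReal.ofReal (w a) * F.d (μ a) (lam a) :=
  fun lam hlam _ => h.trans (iInf₂_le lam hlam)

lemma sum_ofReal_of_mem_stdSimplex {w : Fin K → ℝ} (hw : w ∈ stdSimplex ℝ (Fin K)) :
    ∑ a, ENNReal.ofReal (w a) = 1 := by
  rw [← ENNReal.ofReal_sum_of_nonneg fun a _ => hw.1 a, hw.2, ENNReal.ofReal_one]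

lemma toReal_sum_ofReal_mul {γ : F.means} {μ : Fin K → F.means} {w : Fin K → ℝ}
    (hw : ∀ a, 0 ≤ w a) (s : Finset (Fin K)) :
    (∑ a ∈ s, ENNReal.ofReal (w a) * F.d (μ a) γ).toReal
      = ∑ a ∈ s, w a * (F.d (μ a) γ).toReal := by
  rw [ENNReal.toReal_sum fun a _ => ENNReal.mul_ne_top ENNReal.ofReal_ne_top (d_ne_top _ _)]
  simp [ENNReal.toReal_mul, hw]

lemma sum_ofReal_mul_ne_top {γ : F.means} {μ : Fin K → F.means} {w : Fin K → ℝ}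
    (s : Finset (Fin K)) : ∑ a ∈ s, ENNReal.ofReal (w a) * F.d (μ a) γ ≠ ∞ :=
  ENNReal.sum_ne_top.2 fun _ _ => ENNReal.mul_ne_top ENNReal.ofReal_ne_top (d_ne_top _ _)

section Feasible

variable {γ : F.means} {μ : Fin K → F.means} (hγ : ∀ a, μ a ≠ γ) {lo hi : Fin K}
  (hlo : ∀ a, a ≠ lo → μ lo < μ a) (hhi : ∀ a, a ≠ hi → μ a < μ hi) (hf : F.Feasible γ μ)

include hγ hlo hf in
lemma lo_lt_of_feasible : μ lo < γ := by
  obtain ⟨⟨a, ha⟩, _⟩ := (feasible_iff γ μ).1 hf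
  refine lt_of_le_of_ne ?_ (hγ lo)
  rcases eq_or_ne a lo with rfl | h
  · exact ha
  · exact (hlo a h).le.trans ha

include hγ hhi hf in
lemma lt_hi_of_feasible : γ < μ hi := by
  obtain ⟨_, a, ha⟩ := (feasible_iff γ μ).1 hf
  refine lt_of_le_of_ne ?_ (hγ hi).symm
  rcases eq_or_ne a hi with rfl | h
  · exact ha
  · exact ha.trans (hhi a h).le

include hγ hlo in
lemma d_lt_d_lo (a : Fin K) (ha : ¬ γ < μ a) (h : a ≠ lo) : F.d (μ a) γ < F.d (μ lo) γ :=
  d_left_lt_of_lt_of_lt (hlo a h) (lt_of_le_of_ne (not_lt.1 ha) (hγ a))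

include hhi in
lemma d_lt_d_hi (a : Fin K) (ha : γ < μ a) (h : a ≠ hi) : F.d (μ a) γ < F.d (μ hi) γ :=
  d_left_lt_of_gt_of_gt (hhi a h) ha

-- The two alternatives are U = univ, which lifts the arms below γ, and U = ∅, which lowers the arms
-- above it.
include hγ hf in
lemma le_sums_of_feasible [NeZero K] {n : Fin K → ℝ≥0∞} (hn : ∑ a, n a ≠ ∞) {b : ℝ≥0∞}
    (h : ∀ lam ∈ F.Alt γ μ, F.IsInstance γ lam → b ≤ ∑ a, n a * F.d (μ a) (lam a)) :
    b ≤ ∑ a with ¬ γ < μ a, n a * F.d (μ a) γ ∧ b ≤ ∑ a with γ < μ a, n a * F.d (μ a) γ := by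
  rw [← sum_mul_moveCost_univ, ← sum_mul_moveCost_empty]
  exact ⟨le_sum_mul_moveCost hγ hn h (by simp [hf]), le_sum_mul_moveCost hγ hn h (by simp [hf])⟩

include hγ hlo hhi hf in
lemma mul_le_sum_of_feasible [NeZero K] {n : Fin K → ℝ≥0∞} (hn : ∑ a, n a ≠ ∞) {b : ℝ≥0∞}
    (h : ∀ lam ∈ F.Alt γ μ, F.IsInstance γ lam → b ≤ ∑ a, n a * F.d (μ a) (lam a)) :
    b * (1 / F.d (μ lo) γ + 1 / F.d (μ hi) γ) ≤ ∑ a, n a := by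
  obtain ⟨h1, h2⟩ := le_sums_of_feasible hγ hf hn h
  rw [mul_add, ← Finset.sum_filter_not_add_sum_filter Finset.univ fun a => γ < μ a]
  refine add_le_add (le_sum_div_of_le_sum_mul h1 (fun a ha => ?_) (d_ne_zero (hγ lo))
    (d_ne_top _ _)) (le_sum_div_of_le_sum_mul h2 (fun a ha => ?_) (d_ne_zero (hγ hi))
    (d_ne_top _ _))
  · rcases eq_or_ne a lo with rfl | hne
    · rfl
    · exact (d_lt_d_lo hγ hlo a (Finset.mem_filter.1 ha).2 hne).le
  · rcases eq_or_ne a hi with rfl | hne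
    · rfl
    · exact (d_lt_d_hi hhi a (Finset.mem_filter.1 ha).2 hne).le

include hγ hlo hhi hf in
lemma eq_of_le_info_of_feasible [NeZero K] {w : Fin K → ℝ} (hw : w ∈ stdSimplex ℝ (Fin K))
    (h : (1 / F.d (μ lo) γ + 1 / F.d (μ hi) γ)⁻¹ ≤ F.info γ μ w) (a : Fin K) :
    w a = if a = lo ∨ a = hi then
      (1 / F.d (μ a) γ / (1 / F.d (μ lo) γ + 1 / F.d (μ hi) γ)).toReal else 0 := by
  have hlt := lo_lt_of_feasible hγ hlo hf
  have hgt := lt_hi_of_feasible hγ hhi hf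
  have hne : lo ≠ hi := by
    rintro rfl
    exact lt_asymm hlt hgt
  obtain ⟨h1, h2⟩ := le_sums_of_feasible hγ hf
    (by rw [sum_ofReal_of_mem_stdSimplex hw]; simp) (le_info_of_le h)
  have h1 := ENNReal.toReal_mono (sum_ofReal_mul_ne_top _) h1
  have h2 := ENNReal.toReal_mono (sum_ofReal_mul_ne_top _) h2
  rw [toReal_sum_ofReal_mul hw.1] at h1 h2
  set D : Fin K → ℝ := fun a => (F.d (μ a) γ).toReal with hD
  have hDpos : ∀ a, 0 < D a := fun a => ENNReal.toReal_pos (d_ne_zero (hγ a)) (d_ne_top _ _)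
  set T := 1 / D lo + 1 / D hi with hT
  have hTpos : 0 < T := add_pos (one_div_pos.2 (hDpos _)) (one_div_pos.2 (hDpos _))
  have hTe : (1 / F.d (μ lo) γ + 1 / F.d (μ hi) γ).toReal = T := by
    rw [ENNReal.toReal_add (by simp [d_ne_zero (hγ lo)]) (by simp [d_ne_zero (hγ hi)])]
    simp [hT, hD]
  rw [ENNReal.toReal_inv, hTe] at h1 h2
  have hsum := hw.2
  rw [← Finset.sum_filter_not_add_sum_filter Finset.univ fun a => γ < μ a] at hsum
  have hDlo : ∀ a ∈ Finset.univ.filter (fun a => ¬ γ < μ a), a ≠ lo → D a < D lo :=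
    fun a ha h => (ENNReal.toReal_lt_toReal (d_ne_top _ _) (d_ne_top _ _)).2
      (d_lt_d_lo hγ hlo a (Finset.mem_filter.1 ha).2 h)
  have hDhi : ∀ a ∈ Finset.univ.filter (fun a => γ < μ a), a ≠ hi → D a < D hi :=
    fun a ha h => (ENNReal.toReal_lt_toReal (d_ne_top _ _) (d_ne_top _ _)).2
      (d_lt_d_hi hhi a (Finset.mem_filter.1 ha).2 h)
  have hle : ∀ (s : Finset (Fin K)) (i : Fin K), T⁻¹ ≤ ∑ a ∈ s, w a * D a →
      (∀ a ∈ s, a ≠ i → D a < D i) → T⁻¹ * (1 / D i) ≤ ∑ a ∈ s, w a := by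
    intro s i hs hDi
    rw [mul_one_div, div_le_iff₀ (hDpos i), Finset.sum_mul]
    refine hs.trans (Finset.sum_le_sum fun a ha => mul_le_mul_of_nonneg_left ?_ (hw.1 a))
    rcases eq_or_ne a i with rfl | hai
    · rfl
    · exact (hDi a ha hai).le
  have hl1 := hle _ lo h1 hDlo
  have hl2 := hle _ hi h2 hDhi
  have hTT : T⁻¹ * (1 / D lo) + T⁻¹ * (1 / D hi) = 1 := by
    rw [← mul_add, ← hT, inv_mul_cancel₀ hTpos.ne']
  -- The lower bounds for the two group masses add up to 1, the total mass, so both are equalities.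
  -- Then no mass can sit on a non-extreme arm.
  have he1 : ∑ a with ¬ γ < μ a, w a = T⁻¹ * (1 / D lo) := by linarith
  have he2 : ∑ a with γ < μ a, w a = T⁻¹ * (1 / D hi) := by linarith
  have hz1 := eq_zero_of_le_sum_mul h1 hw.1 hDlo (by
    rw [he1, mul_assoc, one_div_mul_cancel (hDpos _).ne', mul_one])
  have hz2 := eq_zero_of_le_sum_mul h2 hw.1 hDhi (by
    rw [he2, mul_assoc, one_div_mul_cancel (hDpos _).ne', mul_one])
  rw [Finset.sum_eq_single_of_mem lo (by simp [hlt.le]) hz1] at he1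
  rw [Finset.sum_eq_single_of_mem hi (by simp [hgt]) hz2] at he2
  have hval : ∀ a, (1 / F.d (μ a) γ / (1 / F.d (μ lo) γ + 1 / F.d (μ hi) γ)).toReal
      = T⁻¹ * (1 / D a) := by
    intro a
    rw [ENNReal.toReal_div, hTe, ENNReal.toReal_div, ENNReal.toReal_one, div_eq_inv_mul]
  split_ifs with hc
  · rw [hval]
    rcases hc with rfl | rfl
    · exact he1
    · exact he2
  · push Not at hc
    by_cases hg : γ < μ a
    · exact hz2 a (by simpa using hg) hc.2
    · exact hz1 a (by simpa using hg) hc.1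

include hγ hlo hhi hf in
lemma charTime_of_feasible [NeZero K] :
    F.charTime γ μ = 1 / F.d (μ lo) γ + 1 / F.d (μ hi) γ ∧
      ∀ w : Fin K → ℝ, F.IsOptimalWeights γ μ w ↔
        ∀ a, w a = if a = lo ∨ a = hi then
            (1 / F.d (μ a) γ / (1 / F.d (μ lo) γ + 1 / F.d (μ hi) γ)).toReal
          else 0 := by
  have hlt := lo_lt_of_feasible hγ hlo hf
  have hgt := lt_hi_of_feasible hγ hhi hf
  have hne : lo ≠ hi := by
    rintro rfl
    exact lt_asymm hlt hgt
  have key := charTime_eq_and_isOptimalWeights_iff (F := F) hγ (s := {lo, hi}) (by simp) ?_ ?_ ?_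
  · simpa only [Finset.sum_pair hne, Finset.mem_insert, Finset.mem_singleton] using key
  · intro lam hlam
    have : ¬ F.Feasible γ lam := fun h => hlam (iff_of_true h hf)
    rw [feasible_iff] at this
    by_cases h : lam hi ≤ γ
    · exact ⟨hi, by simp, d_le_d_of_cross (Or.inr ⟨hgt.le, h⟩)⟩
    · refine ⟨lo, by simp, d_le_d_of_cross (Or.inl ⟨hlt.le, ?_⟩)⟩
      by_contra! h'
      exact this ⟨⟨lo, h'.le⟩, hi, (not_le.1 h).le⟩
  · intro w hw
    rw [Finset.sum_pair hne]
    refine le_of_le_of_eq ?_ (sum_ofReal_of_mem_stdSimplex hw)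
    exact mul_le_sum_of_feasible hγ hlo hhi hf
      (by rw [sum_ofReal_of_mem_stdSimplex hw]; simp) (le_info_of_le le_rfl)
  · intro w hw h
    simp only [Finset.sum_pair hne, Finset.mem_insert, Finset.mem_singleton] at h ⊢
    exact eq_of_le_info_of_feasible hγ hlo hhi hf hw h

end Feasible

section Infeasible

variable {γ : F.means} {μ : Fin K → F.means} (hγ : ∀ a, μ a ≠ γ) (hf : ¬ F.Feasible γ μ)

-- All arms lie on one side of γ. Moving only `a` across makes the vector feasible, since K ≥ 2
-- leaves another arm behind.
include hγ hf in
lemma le_mul_of_not_feasible (hK : 2 ≤ K) {n : Fin K → ℝ≥0∞} (hn : ∑ a, n a ≠ ∞) {b : ℝ≥0∞}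
    (h : ∀ lam ∈ F.Alt γ μ, F.IsInstance γ lam → b ≤ ∑ a, n a * F.d (μ a) (lam a)) (a : Fin K) :
    b ≤ n a * F.d (μ a) γ := by
  have : NeZero K := ⟨by lia⟩
  have : Nontrivial (Fin K) := Fin.nontrivial_iff_two_le.2 hK
  obtain ⟨c, hc⟩ := exists_ne a
  have hside : (∀ i, γ < μ i) ∨ ∀ i, ¬ γ < μ i := by
    by_contra! hcon
    obtain ⟨⟨i, hi⟩, j, hj⟩ := hcon
    exact hf ((feasible_iff γ μ).2 ⟨⟨i, hi⟩, j, hj.le⟩)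
  obtain ⟨U, hU, hne, hnu⟩ : ∃ U : Finset (Fin K), (∀ i, moveCost γ μ U i
      = if i = a then F.d (μ i) γ else 0) ∧ U.Nonempty ∧ U ≠ Finset.univ := by
    rcases hside with hs | hs
    · refine ⟨Finset.univ.erase a, fun i => ?_, ⟨c, by simpa using hc⟩, fun h => ?_⟩
      · by_cases hi : i = a <;> simp [moveCost, hs, hi]
      · have := Finset.mem_univ a
        rw [← h] at this
        simp at this
    · refine ⟨{a}, fun i => ?_, by simp, fun h => ?_⟩
      · by_cases hi : i = a <;> simp [moveCost, hs, hi]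
      · have := Finset.mem_univ c
        rw [← h] at this
        simp [hc] at this
  have := le_sum_mul_moveCost hγ hn h (U := U) (by simp [hf, hne, hnu])
  simpa [hU] using this

include hγ hf in
lemma mul_le_sum_of_not_feasible (hK : 2 ≤ K) {n : Fin K → ℝ≥0∞} (hn : ∑ a, n a ≠ ∞) {b : ℝ≥0∞}
    (h : ∀ lam ∈ F.Alt γ μ, F.IsInstance γ lam → b ≤ ∑ a, n a * F.d (μ a) (lam a)) :
    b * ∑ a, 1 / F.d (μ a) γ ≤ ∑ a, n a := by
  rw [Finset.mul_sum]
  refine Finset.sum_le_sum fun a _ => ?_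
  rw [mul_one_div, ENNReal.div_le_iff (d_ne_zero (hγ a)) (d_ne_top _ _)]
  exact le_mul_of_not_feasible hγ hf hK hn h a

include hγ hf in
lemma charTime_of_not_feasible (hK : 2 ≤ K) :
    F.charTime γ μ = ∑ i, 1 / F.d (μ i) γ ∧
      ∀ w : Fin K → ℝ, F.IsOptimalWeights γ μ w ↔
        ∀ a, w a = (1 / F.d (μ a) γ / ∑ i, 1 / F.d (μ i) γ).toReal := by
  have : NeZero K := ⟨by lia⟩
  have hd0 : ∀ a, F.d (μ a) γ ≠ 0 := fun a => d_ne_zero (hγ a)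
  have key := charTime_eq_and_isOptimalWeights_iff (F := F) hγ (s := Finset.univ)
    Finset.univ_nonempty ?_ ?_ ?_
  · simpa only [Finset.mem_univ, if_true] using key
  · intro lam hlam
    have hl : F.Feasible γ lam := by
      by_contra h
      exact hlam (iff_of_false h hf)
    obtain ⟨⟨i, hi⟩, j, hj⟩ := (feasible_iff γ lam).1 hl
    by_cases h : γ ≤ μ i
    · exact ⟨i, by simp, d_le_d_of_cross (Or.inr ⟨h, hi⟩)⟩
    · refine ⟨j, by simp, d_le_d_of_cross (Or.inl ⟨?_, hj⟩)⟩
      by_contra! h'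
      exact hf ((feasible_iff γ μ).2 ⟨⟨i, (not_le.1 h).le⟩, j, h'.le⟩)
  · intro w hw
    refine le_of_le_of_eq ?_ (sum_ofReal_of_mem_stdSimplex hw)
    exact mul_le_sum_of_not_feasible hγ hf hK
      (by rw [sum_ofReal_of_mem_stdSimplex hw]; simp) (le_info_of_le le_rfl)
  · intro w hw h
    simp only [Finset.mem_univ, if_true]
    set T := ∑ a, 1 / F.d (μ a) γ with hT
    have hT0 : T ≠ 0 := fun h0 => by
      have := Finset.sum_eq_zero_iff.1 h0 0 (Finset.mem_univ _)
      simp [d_ne_top] at this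
    have hTt : T ≠ ∞ := by simp [hT, ENNReal.sum_eq_top, hd0]
    have hge : ∀ a, (1 / F.d (μ a) γ / T).toReal ≤ w a := by
      intro a
      refine ENNReal.toReal_le_of_le_ofReal (hw.1 a) ?_
      have := le_mul_of_not_feasible hγ hf hK
        (by rw [sum_ofReal_of_mem_stdSimplex hw]; simp) (le_info_of_le h) a
      rw [div_eq_mul_inv (_ / _) T, mul_comm, mul_one_div]
      exact (ENNReal.div_le_iff (hd0 a) (d_ne_top _ _)).2 this
    -- The pointwise lower bounds `hge` add up to 1, as do the weights, so each of them is attained.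
    have hsum : ∑ a, (1 / F.d (μ a) γ / T).toReal = 1 := by
      rw [← ENNReal.toReal_sum fun a _ => ENNReal.div_ne_top (by simp [hd0 a]) hT0]
      simp only [div_eq_mul_inv (_ / _) T]
      rw [← Finset.sum_mul, ← hT, ENNReal.mul_inv_cancel hT0 hTt, ENNReal.toReal_one]
    intro a
    refine ((Finset.sum_eq_sum_iff_of_le fun a _ => hge a).1 ?_ a (Finset.mem_univ a)).symm
    rw [hsum, hw.2]

end Infeasible

end Game

end ExpFamily

end CHM

/-! ### The law of the trajectory, change of measure and Wald's identity. -/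

namespace CHM

/-- The first `n` rounds of a trajectory. -/
def past {K : ℕ} (n : ℕ) (ω : Traj K) (i : Fin n) : Fin K × ℝ := ω i

lemma measurable_past {K : ℕ} (n : ℕ) : Measurable (past (K := K) n) := by
  unfold past; fun_prop

lemma measurableSet_hist_iff {K n : ℕ} {E : Set (Traj K)} :
    MeasurableSet[hist K n] E ↔
      ∃ B : Set (Fin n → Fin K × ℝ), MeasurableSet B ∧ past n ⁻¹' B = E := Iff.rfl

lemma past_succ {K : ℕ} (n : ℕ) (ω : Traj K) :
    past (n + 1) ω = Fin.snoc (α := fun _ => Fin K × ℝ) (past n ω) (ω n) := by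
  funext i
  refine Fin.lastCases ?_ (fun j => ?_) i
  · simp [past]
  · simp [past]

lemma measurable_snoc {K n : ℕ} : Measurable fun p : (Fin n → Fin K × ℝ) × (Fin K × ℝ) =>
    (Fin.snoc (α := fun _ => Fin K × ℝ) p.1 p.2 : Fin (n + 1) → Fin K × ℝ) := by
  refine measurable_pi_iff.2 fun i => ?_
  refine Fin.lastCases ?_ (fun j => ?_) i
  · simpa using measurable_snd
  · simp only [Fin.snoc_castSucc]
    fun_prop

namespace Strategy

variable {K : ℕ} (S : Strategy K) (ν : Fin K → Measure ℝ) [∀ a, IsProbabilityMeasure (ν a)]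

instance : IsProbabilityMeasure (S.law ν) := by
  unfold law; infer_instance

lemma lintegral_law_zero {f : Fin K × ℝ → ℝ≥0∞} (hf : Measurable f) :
    ∫⁻ ω, f (ω 0) ∂S.law ν = ∫⁻ y, f y ∂S.step ν 0 Fin.elim0 := by
  have h : (S.law ν).map (Preorder.frestrictLe 0) = (S.step ν 0 Fin.elim0).map
      (MeasurableEquiv.piUnique (fun _ : Finset.Iic 0 => Fin K × ℝ)).symm := by
    rw [law, Kernel.trajMeasure, Measure.map_comp _ _ (by fun_prop),
      Kernel.traj_map_frestrictLe_of_le le_rfl, Measure.deterministic_comp_eq_map]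
    exact Measure.map_id
  have h1 : ∫⁻ ω, f (ω 0) ∂S.law ν
      = ∫⁻ u, f (u ⟨0, Finset.mem_Iic.2 le_rfl⟩) ∂(S.law ν).map (Preorder.frestrictLe 0) := by
    rw [lintegral_map (by fun_prop) (by fun_prop)]
    rfl
  rw [h1, h, lintegral_map (by fun_prop) (by fun_prop)]
  rfl

lemma lintegral_law_step (n : ℕ) {f : (Fin n → Fin K × ℝ) × (Fin K × ℝ) → ℝ≥0∞}
    (hf : Measurable f) :
    ∫⁻ ω, f (past n ω, ω n) ∂S.law ν
      = ∫⁻ ω, ∫⁻ y, f (past n ω, y) ∂S.step ν n (past n ω) ∂S.law ν := by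
  cases n with
  | zero =>
    have h0 : ∀ ω : Traj K, past 0 ω = Fin.elim0 := fun ω => Subsingleton.elim _ _
    simp only [h0]
    rw [S.lintegral_law_zero ν (f := fun y => f (Fin.elim0, y)) (by fun_prop)]
    simp
  | succ m =>
    have h : (S.law ν).map (Preorder.frestrictLe m)
          ⊗ₘ (S.step ν (m + 1)).comap (toFin K m) (measurable_toFin K m)
        = (S.law ν).map fun ω => (Preorder.frestrictLe m ω, ω (m + 1)) :=
      Kernel.map_frestrictLe_trajMeasure_compProd_eq_map_trajMeasure
    have hm := measurable_toFin K m
    have hg : Measurable fun p : (Finset.Iic m → Fin K × ℝ) × (Fin K × ℝ) =>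
        f (toFin K m p.1, p.2) := by fun_prop
    have h1 := congrArg (fun M => ∫⁻ p, f (toFin K m p.1, p.2) ∂M) h
    beta_reduce at h1
    rw [Measure.lintegral_compProd hg, lintegral_map hg (by fun_prop),
      lintegral_map (Measurable.lintegral_kernel_prod_right' hg) (by fun_prop)] at h1
    exact h1.symm

lemma lintegral_step (n : ℕ) (h : Fin n → Fin K × ℝ) {g : Fin K × ℝ → ℝ≥0∞} (hg : Measurable g) :
    ∫⁻ y, g y ∂S.step ν n h = ∫⁻ a, ∫⁻ x, g (a, x) ∂ν a ∂S.policy n h := by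
  rw [step, Kernel.lintegral_compProd _ _ _ hg]
  rfl

lemma lintegral_law_succ (n : ℕ) {f : (Fin n → Fin K × ℝ) × (Fin K × ℝ) → ℝ≥0∞}
    (hf : Measurable f) :
    ∫⁻ ω, f (past n ω, ω n) ∂S.law ν = ∫⁻ ω, ∫⁻ a, ∫⁻ x, f (past n ω, (a, x)) ∂ν a
      ∂S.policy n (past n ω) ∂S.law ν := by
  rw [S.lintegral_law_step ν n hf]
  congr 1 with ω
  exact S.lintegral_step ν n _ (g := fun y => f (past n ω, y)) (by fun_prop)

/-- Given the past and the arm, the reward of the next round is distributed according to the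
law of the arm. -/
lemma map_restrict_law {n : ℕ} {E : Set (Traj K)} (hE : MeasurableSet[hist K n] E) (a : Fin K) :
    ((S.law ν).restrict (E ∩ {ω | (ω n).1 = a})).map (fun ω => (ω n).2)
      = S.law ν (E ∩ {ω | (ω n).1 = a}) • ν a := by
  obtain ⟨B, hB, rfl⟩ := measurableSet_hist_iff.1 hE
  have hp := measurable_past (K := K) n
  -- The integral over the reward factors out `ν a C`. The remaining factor does not depend on `C`
  -- and is identified by taking `C = univ`.
  have key : ∀ C : Set ℝ, MeasurableSet C →
      S.law ν (past n ⁻¹' B ∩ {ω | (ω n).1 = a} ∩ (fun ω => (ω n).2) ⁻¹' C)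
        = ν a C * ∫⁻ ω, ∫⁻ i, (B ×ˢ {a}).indicator 1 (past n ω, i)
          ∂S.policy n (past n ω) ∂S.law ν := by
    intro C hC
    have hs : MeasurableSet (B ×ˢ ({a} ×ˢ C) : Set ((Fin n → Fin K × ℝ) × (Fin K × ℝ))) :=
      hB.prod ((measurableSet_singleton a).prod hC)
    have h1 : past n ⁻¹' B ∩ {ω | (ω n).1 = a} ∩ (fun ω => (ω n).2) ⁻¹' C
        = (fun ω : Traj K => (past n ω, ω n)) ⁻¹' (B ×ˢ ({a} ×ˢ C)) := by
      ext ω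
      simp [and_assoc]
    have hm : Measurable fun ω : Traj K => (past n ω, ω n) := by fun_prop
    rw [h1, ← lintegral_indicator_one (hm hs)]
    refine (S.lintegral_law_succ ν n (f := (B ×ˢ ({a} ×ˢ C)).indicator 1)
      (measurable_one.indicator hs)).trans ?_
    have h2 : ∀ ω i, ∫⁻ x, (B ×ˢ ({a} ×ˢ C)).indicator (1 : (Fin n → Fin K × ℝ) × (Fin K × ℝ) → ℝ≥0∞)
          (past n ω, (i, x)) ∂ν i
        = ν a C * (B ×ˢ {a}).indicator 1 (past n ω, i) := by
      intro ω i
      by_cases hω : past n ω ∈ B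
      · rcases eq_or_ne i a with rfl | hi
        · have : (fun x => (B ×ˢ ({i} ×ˢ C)).indicator (1 : (Fin n → Fin K × ℝ) × (Fin K × ℝ) → ℝ≥0∞)
          (past n ω, (i, x)))
              = C.indicator 1 := by
            funext x
            by_cases hx : x ∈ C <;> simp [hω, hx]
          rw [this, lintegral_indicator_one hC]
          simp [hω]
        · simp [Set.indicator, hi]
      · simp [Set.indicator, hω]
    simp only [h2]
    have hind : Measurable ((B ×ˢ {a}).indicator (1 : (Fin n → Fin K × ℝ) × Fin K → ℝ≥0∞)) :=
      measurable_one.indicator (hB.prod (measurableSet_singleton a))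
    rw [← lintegral_const_mul]
    · congr 1 with ω
      exact lintegral_const_mul _ (by fun_prop)
    · exact (Measurable.lintegral_kernel_prod_right' hind).comp hp
  have huniv := key Set.univ MeasurableSet.univ
  rw [Set.preimage_univ, Set.inter_univ, measure_univ, one_mul] at huniv
  ext C hC
  rw [Measure.map_apply (by fun_prop) hC, Measure.restrict_apply
    ((show Measurable fun ω : Traj K => (ω n).2 by fun_prop) hC), Set.inter_comm, key C hC,
    Measure.smul_apply, huniv, smul_eq_mul, mul_comm]

/-- The likelihood ratio of a finite history. -/
noncomputable def likelihood (ρ : Fin K → ℝ → ℝ≥0∞) (n : ℕ) (h : Fin n → Fin K × ℝ) : ℝ≥0∞ :=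
  ∏ i, ρ (h i).1 (h i).2

lemma measurable_uncurry_of_countable {β : Type*} [MeasurableSpace β] {ρ : Fin K → ℝ → β}
    (hρ : ∀ a, Measurable (ρ a)) : Measurable fun p : Fin K × ℝ => ρ p.1 p.2 :=
  measurable_from_prod_countable_right hρ

lemma measurable_likelihood {ρ : Fin K → ℝ → ℝ≥0∞} (hρ : ∀ a, Measurable (ρ a)) (n : ℕ) :
    Measurable (likelihood ρ n) := by
  have := measurable_uncurry_of_countable hρ
  unfold likelihood
  exact Finset.measurable_fun_prod _ fun i _ => this.comp (measurable_pi_apply i)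

/-- Change of measure on the first `n` rounds. -/
lemma lintegral_law_withDensity {ν' : Fin K → Measure ℝ} [∀ a, IsProbabilityMeasure (ν' a)]
    {ρ : Fin K → ℝ → ℝ≥0∞} (hρ : ∀ a, Measurable (ρ a))
    (hν : ∀ a, ν' a = (ν a).withDensity (ρ a)) (n : ℕ) {f : (Fin n → Fin K × ℝ) → ℝ≥0∞}
    (hf : Measurable f) :
    ∫⁻ ω, f (past n ω) ∂S.law ν' = ∫⁻ ω, f (past n ω) * likelihood ρ n (past n ω) ∂S.law ν := by
  induction n with
  | zero =>
    have h0 : ∀ ω : Traj K, past 0 ω = Fin.elim0 := fun ω => Subsingleton.elim _ _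
    simp [h0, likelihood]
  | succ n ih =>
    have hu := measurable_uncurry_of_countable hρ
    have hl := measurable_likelihood hρ n
    have hs := measurable_snoc (K := K) (n := n)
    have hp := measurable_past (K := K) n
    set f' : (Fin n → Fin K × ℝ) × (Fin K × ℝ) → ℝ≥0∞ := fun p =>
      f (Fin.snoc (α := fun _ => Fin K × ℝ) p.1 p.2) with hf'
    have hf'm : Measurable f' := hf.comp hs
    have hlik : ∀ ω : Traj K, likelihood ρ (n + 1) (past (n + 1) ω)
        = likelihood ρ n (past n ω) * ρ (ω n).1 (ω n).2 := by
      intro ω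
      rw [likelihood, Fin.prod_univ_castSucc]
      rfl
    -- The policy is the same under both laws, so one round changes the density only through its
    -- reward.
    have hstep : ∀ ω, ∫⁻ y, f' (past n ω, y) * (likelihood ρ n (past n ω) * ρ y.1 y.2)
          ∂S.step ν n (past n ω)
        = (∫⁻ y, f' (past n ω, y) ∂S.step ν' n (past n ω)) * likelihood ρ n (past n ω) := by
      intro ω
      rw [S.lintegral_step ν n _ (g := fun y =>
          f' (past n ω, y) * (likelihood ρ n (past n ω) * ρ y.1 y.2)) (by fun_prop),
        S.lintegral_step ν' n _ (g := fun y => f' (past n ω, y)) (by fun_prop),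
        lintegral_fintype, lintegral_fintype, Finset.sum_mul]
      refine Finset.sum_congr rfl fun a _ => ?_
      rw [hν a, lintegral_withDensity_eq_lintegral_mul _ (hρ a) (by fun_prop), mul_right_comm]
      congr 1
      rw [← lintegral_mul_const _ (by have := hρ a; fun_prop)]
      refine lintegral_congr fun x => ?_
      simp only [Pi.mul_apply]
      ring
    calc ∫⁻ ω, f (past (n + 1) ω) ∂S.law ν'
        = ∫⁻ ω, f' (past n ω, ω n) ∂S.law ν' := by simp only [past_succ, hf']
      _ = ∫⁻ ω, ∫⁻ y, f' (past n ω, y) ∂S.step ν' n (past n ω) ∂S.law ν' :=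
          S.lintegral_law_step ν' n hf'm
      _ = ∫⁻ ω, (∫⁻ y, f' (past n ω, y) ∂S.step ν' n (past n ω))
            * likelihood ρ n (past n ω) ∂S.law ν :=
          ih (f := fun h => ∫⁻ y, f' (h, y) ∂S.step ν' n h)
            (Measurable.lintegral_kernel_prod_right' hf'm)
      _ = ∫⁻ ω, f' (past n ω, ω n) * (likelihood ρ n (past n ω) * ρ (ω n).1 (ω n).2)
            ∂S.law ν := by
          simp only [← hstep]
          exact (S.lintegral_law_step ν n
            (f := fun p => f' p * (likelihood ρ n p.1 * ρ p.2.1 p.2.2)) (by fun_prop)).symm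
      _ = _ := lintegral_congr fun ω => by rw [hlik, past_succ]

/-- The time-i σ-algebra contains the rounds 0, …, i - 1. Whether round i takes place is thus known
before its arm and reward are seen, which is what Wald's identity needs. -/
lemma measurableSet_hist_lt {σ : Traj K → ℕ}
    (hσ : ∀ k, MeasurableSet[hist K k] {ω | σ ω = k}) (i : ℕ) :
    MeasurableSet[hist K i] {ω | i < σ ω} := by
  have : {ω | i < σ ω} = (⋃ k ∈ Finset.range (i + 1), {ω | σ ω = k})ᶜ := by
    ext ω
    simp only [Set.mem_ofPred_eq, Finset.mem_range, Set.mem_compl_iff, Set.mem_iUnion, exists_prop,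
      exists_eq_right', not_lt]
    lia
  rw [this]
  refine MeasurableSet.compl (Finset.measurableSet_biUnion _ fun k hk => ?_)
  exact (hist K).mono (Nat.lt_succ_iff.1 (Finset.mem_range.1 hk)) _ (hσ k)

/-- Change of measure at a bounded stopping time. -/
lemma lintegral_indicator_likelihood {ν' : Fin K → Measure ℝ}
    [∀ a, IsProbabilityMeasure (ν' a)] {ρ : Fin K → ℝ → ℝ≥0∞} (hρ : ∀ a, Measurable (ρ a))
    (hν : ∀ a, ν' a = (ν a).withDensity (ρ a)) {σ : Traj K → ℕ} {n : ℕ} (hσn : ∀ ω, σ ω ≤ n)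
    {G : Set (Traj K)} (hG : ∀ k, MeasurableSet[hist K k] (G ∩ {ω | σ ω = k})) :
    ∫⁻ ω, G.indicator 1 ω * ∏ i ∈ Finset.range (σ ω), ρ (ω i).1 (ω i).2 ∂S.law ν
      = S.law ν' G := by
  have hset : ∀ k, MeasurableSet (G ∩ {ω | σ ω = k}) := fun k => (hist K).le k _ (hG k)
  -- On {σ = k} both the event and the likelihood depend on the first k rounds only, so the change
  -- of measure at a fixed horizon applies.
  have hk : ∀ k, S.law ν' (G ∩ {ω | σ ω = k}) = ∫⁻ ω, (G ∩ {ω | σ ω = k}).indicator 1 ω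
      * ∏ i ∈ Finset.range k, ρ (ω i).1 (ω i).2 ∂S.law ν := by
    intro k
    obtain ⟨B, hB, hBe⟩ := measurableSet_hist_iff.1 (hG k)
    have := S.lintegral_law_withDensity ν hρ hν k (f := B.indicator 1) (measurable_one.indicator hB)
    rw [← hBe, ← lintegral_indicator_one (measurable_past k hB)]
    refine this.trans (lintegral_congr fun ω => ?_)
    rw [Finset.prod_range]
    rfl
  have hu := measurable_uncurry_of_countable hρ
  have hpm : ∀ k, Measurable fun ω : Traj K => ∏ i ∈ Finset.range k, ρ (ω i).1 (ω i).2 :=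
    fun k => Finset.measurable_fun_prod _ fun i _ => hu.comp (measurable_pi_apply i)
  have hdecomp : G = ⋃ k ∈ Finset.range (n + 1), (G ∩ {ω | σ ω = k}) := by
    ext ω
    simp only [Set.mem_iUnion, Finset.mem_range, Set.mem_inter_iff, Set.mem_ofPred_eq,
      exists_prop]
    exact ⟨fun h => ⟨σ ω, Nat.lt_succ_of_le (hσn ω), h, rfl⟩, fun ⟨_, _, h, _⟩ => h⟩
  conv_rhs => rw [hdecomp]
  rw [measure_biUnion_finset (fun i _ j _ hij => Set.disjoint_left.2
    fun ω hi hj => hij (hi.2.symm.trans hj.2)) fun k _ => hset k]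
  simp only [hk]
  refine Eq.trans (lintegral_congr fun ω => ?_) (lintegral_finsetSum _
    fun k _ => (measurable_one.indicator (hset k)).mul (hpm k))
  rw [Finset.sum_eq_single_of_mem (σ ω) (Finset.mem_range.2 (Nat.lt_succ_of_le (hσn ω)))]
  · by_cases h : ω ∈ G <;> simp [h]
  · intro k _ hk
    simp [hk.symm]

/-- Wald's identity for a bounded stopping time. -/
lemma integrable_and_integral_sum_range {φ : Fin K → ℝ → ℝ}
    (hφi : ∀ a, Integrable (φ a) (ν a)) {σ : Traj K → ℕ} {n : ℕ} (hσn : ∀ ω, σ ω ≤ n)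
    (hσ : ∀ k, MeasurableSet[hist K k] {ω | σ ω = k}) :
    Integrable (fun ω => ∑ i ∈ Finset.range (σ ω), φ (ω i).1 (ω i).2) (S.law ν) ∧
    ∫ ω, ∑ i ∈ Finset.range (σ ω), φ (ω i).1 (ω i).2 ∂S.law ν
      = ∑ a, (∑ i ∈ Finset.range n, (S.law ν).real ({ω | i < σ ω} ∩ {ω | (ω i).1 = a}))
        * ∫ x, φ a x ∂ν a := by
  have hA : ∀ i a, MeasurableSet {ω : Traj K | (ω i).1 = a} := fun i a =>
    measurableSet_eq_fun (by fun_prop) measurable_const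
  have hE : ∀ i a, MeasurableSet ({ω | i < σ ω} ∩ {ω : Traj K | (ω i).1 = a}) := fun i a =>
    ((hist K).le i _ (measurableSet_hist_lt hσ i)).inter (hA i a)
  have hmap := fun i a => S.map_restrict_law ν (measurableSet_hist_lt hσ i) a
  have hsnd : ∀ i, Measurable fun ω : Traj K => (ω i).2 := fun i => by fun_prop
  have hint : ∀ i a, Integrable (fun ω => φ a (ω i).2)
      ((S.law ν).restrict ({ω | i < σ ω} ∩ {ω | (ω i).1 = a})) := by
    intro i a
    have : Integrable (φ a) (((S.law ν).restrict ({ω | i < σ ω} ∩ {ω | (ω i).1 = a})).map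
        (fun ω => (ω i).2)) := by
      rw [hmap]
      exact (hφi a).smul_measure (measure_ne_top _ _)
    exact this.comp_measurable (hsnd i)
  have hval : ∀ i a, ∫ ω, ({ω | i < σ ω} ∩ {ω : Traj K | (ω i).1 = a}).indicator
      (fun ω => φ a (ω i).2) ω ∂S.law ν
      = (S.law ν).real ({ω | i < σ ω} ∩ {ω | (ω i).1 = a}) * ∫ x, φ a x ∂ν a := by
    intro i a
    rw [integral_indicator (hE i a), ← integral_map (f := φ a) (hsnd i).aemeasurable, hmap,
      integral_smul_measure]
    · rfl
    · rw [hmap]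
      exact (hφi a).aestronglyMeasurable.smul_measure _
  -- The sum of random length becomes a sum of fixed length with indicators of events on which the
  -- reward has law `ν a`.
  have heq : (fun ω => ∑ i ∈ Finset.range (σ ω), φ (ω i).1 (ω i).2)
      = fun ω => ∑ i ∈ Finset.range n, ∑ a, ({ω | i < σ ω} ∩ {ω : Traj K | (ω i).1 = a}).indicator
        (fun ω => φ a (ω i).2) ω := by
    funext ω
    have h1 : ∀ i, ∑ a, ({ω | i < σ ω} ∩ {ω : Traj K | (ω i).1 = a}).indicator
        (fun ω => φ a (ω i).2) ω = if i < σ ω then φ (ω i).1 (ω i).2 else 0 := by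
      intro i
      rw [Finset.sum_eq_single (ω i).1]
      · by_cases h : i < σ ω <;> simp [h]
      · intro a _ ha
        simp [ha.symm]
      · simp
    simp only [h1]
    rw [← Finset.sum_filter]
    congr 1
    ext i
    have := hσn ω
    simp only [Finset.mem_range, Finset.mem_filter]
    lia
  have hint' : ∀ i a, Integrable (fun ω => ({ω | i < σ ω} ∩ {ω : Traj K | (ω i).1 = a}).indicator
      (fun ω => φ a (ω i).2) ω) (S.law ν) := fun i a =>
    (integrable_indicator_iff (hE i a)).2 (hint i a)
  rw [heq]
  refine ⟨integrable_finsetSum _ fun i _ => integrable_finsetSum _ fun a _ => hint' i a, ?_⟩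
  rw [integral_finsetSum _ fun i _ => integrable_finsetSum _ fun a _ => hint' i a]
  simp only [integral_finsetSum _ fun a _ => hint' _ a, hval, Finset.sum_mul]
  exact Finset.sum_comm

/-- The transportation inequality at a bounded stopping time. -/
lemma log_mul_sub_le_sum {ν' : Fin K → Measure ℝ} [∀ a, IsProbabilityMeasure (ν' a)]
    {φ : Fin K → ℝ → ℝ} (hφ : ∀ a, Measurable (φ a)) (hφi : ∀ a, Integrable (φ a) (ν a))
    (hν : ∀ a, ν' a = (ν a).withDensity fun x => ENNReal.ofReal (Real.exp (-φ a x)))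
    {σ : Traj K → ℕ} {n : ℕ} (hσn : ∀ ω, σ ω ≤ n)
    (hσ : ∀ k, MeasurableSet[hist K k] {ω | σ ω = k})
    {G : Set (Traj K)} (hG : ∀ k, MeasurableSet[hist K k] (G ∩ {ω | σ ω = k}))
    {δ : ℝ} (hδ : 0 < δ) (hQ : S.law ν' G ≤ ENNReal.ofReal δ) :
    Real.log (1 / δ) * (S.law ν).real G - Real.log 2
      ≤ ∑ a, (∑ i ∈ Finset.range n, (S.law ν).real ({ω | i < σ ω} ∩ {ω | (ω i).1 = a}))
        * ∫ x, φ a x ∂ν a := by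
  obtain ⟨hZi, hZ⟩ := S.integrable_and_integral_sum_range ν hφi hσn hσ
  rw [← hZ]
  set Z : Traj K → ℝ := fun ω => ∑ i ∈ Finset.range (σ ω), φ (ω i).1 (ω i).2 with hZdef
  set ρ : Fin K → ℝ → ℝ≥0∞ := fun a x => ENNReal.ofReal (Real.exp (-φ a x))
  have hρ : ∀ a, Measurable (ρ a) := fun a => by have := hφ a; fun_prop
  have hprod : ∀ ω : Traj K, ∏ i ∈ Finset.range (σ ω), ρ (ω i).1 (ω i).2
      = ENNReal.ofReal (Real.exp (-Z ω)) := by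
    intro ω
    rw [hZdef, ← Finset.sum_neg_distrib, Real.exp_sum,
      ENNReal.ofReal_prod_of_nonneg fun _ _ => (Real.exp_pos _).le]
  have hGm : MeasurableSet G := by
    have : G = ⋃ k, (G ∩ {ω | σ ω = k}) := by ext ω; simp
    rw [this]
    exact MeasurableSet.iUnion fun k => (hist K).le k _ (hG k)
  have hcG := S.lintegral_indicator_likelihood ν hρ hν hσn hG
  have hcU := S.lintegral_indicator_likelihood ν hρ hν hσn (G := Set.univ)
    (by simpa using hσ)
  simp only [hprod] at hcG hcU
  simp only [Set.indicator_univ, Pi.one_apply, one_mul, measure_univ] at hcU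
  have hem : AEStronglyMeasurable (fun ω => Real.exp (-Z ω)) (S.law ν) :=
    Real.continuous_exp.comp_aestronglyMeasurable hZi.neg.aestronglyMeasurable
  -- The two parts integrate to 1 and to at most (1/δ)·δ = 1 by change of measure. The factor 1/2
  -- brings the total down to 1 and is the origin of the term log 2.
  have hbound : ∫⁻ ω, ENNReal.ofReal ((1 + 1 / δ * G.indicator 1 ω) * Real.exp (-Z ω) / 2)
      ∂S.law ν ≤ 1 := by
    have h1 : ∀ ω, ENNReal.ofReal ((1 + 1 / δ * G.indicator 1 ω) * Real.exp (-Z ω) / 2)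
        = (ENNReal.ofReal (Real.exp (-Z ω)) + ENNReal.ofReal (1 / δ)
          * (G.indicator 1 ω * ENNReal.ofReal (Real.exp (-Z ω)))) * 2⁻¹ := by
      intro ω
      rw [ENNReal.ofReal_div_of_pos two_pos, ENNReal.div_eq_inv_mul, mul_comm]
      congr 1
      · by_cases h : ω ∈ G
        · simp only [Set.indicator_of_mem h, Pi.one_apply, mul_one, one_mul]
          rw [ENNReal.ofReal_mul (by positivity), ENNReal.ofReal_add (by positivity)
            (by positivity), ENNReal.ofReal_one, add_mul, one_mul]
        · simp [h]
      · simp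
    simp only [h1]
    rw [lintegral_mul_const'' _ ?_, lintegral_add_left' ?_, lintegral_const_mul'' _ ?_, hcU, hcG]
    · calc (1 + ENNReal.ofReal (1 / δ) * S.law ν' G) * 2⁻¹
          ≤ (1 + ENNReal.ofReal (1 / δ) * ENNReal.ofReal δ) * 2⁻¹ := by gcongr
        _ = 1 := by
          rw [← ENNReal.ofReal_mul (by positivity), one_div_mul_cancel hδ.ne', ENNReal.ofReal_one,
            one_add_one_eq_two, ENNReal.mul_inv_cancel (by simp) (by simp)]
    · exact (measurable_one.indicator hGm).aemeasurable.mul hem.aemeasurable.ennreal_ofReal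
    · exact hem.aemeasurable.ennreal_ofReal
    · exact hem.aemeasurable.ennreal_ofReal.add
        (((measurable_one.indicator hGm).aemeasurable.mul
          hem.aemeasurable.ennreal_ofReal).const_mul _)
  have hnn : ∀ ω, 0 ≤ (1 + 1 / δ * G.indicator 1 ω) * Real.exp (-Z ω) / 2 := by
    intro ω
    have : (0 : ℝ) ≤ G.indicator 1 ω := Set.indicator_nonneg (fun _ _ => zero_le_one) _
    positivity
  have hRm : AEStronglyMeasurable (fun ω => (1 + 1 / δ * G.indicator 1 ω) * Real.exp (-Z ω) / 2)
      (S.law ν) := by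
    have : Measurable (G.indicator (1 : Traj K → ℝ)) := measurable_one.indicator hGm
    have h2 : Measurable fun ω => 1 + 1 / δ * G.indicator (1 : Traj K → ℝ) ω := by fun_prop
    exact ((h2.aestronglyMeasurable.mul hem).mul_const (1 / 2)).congr
      (Eventually.of_forall fun ω => by simp [div_eq_mul_inv])
  have hRi : Integrable (fun ω => (1 + 1 / δ * G.indicator 1 ω) * Real.exp (-Z ω) / 2)
      (S.law ν) := by
    refine ⟨hRm, ?_⟩
    rw [hasFiniteIntegral_iff_ofReal (Eventually.of_forall hnn)]
    exact hbound.trans_lt ENNReal.one_lt_top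
  have hR1 : ∫ ω, (1 + 1 / δ * G.indicator 1 ω) * Real.exp (-Z ω) / 2 ∂S.law ν ≤ 1 := by
    rw [integral_eq_lintegral_of_nonneg_ae (Eventually.of_forall hnn) hRm]
    exact ENNReal.toReal_le_of_le_ofReal zero_le_one (by simpa using hbound)
  have hGi : Integrable (fun ω => Real.log (1 / δ) * G.indicator (1 : Traj K → ℝ) ω) (S.law ν) :=
    ((integrable_const (1 : ℝ)).indicator hGm).const_mul _
  have hGZ : Integrable (fun ω => Real.log (1 / δ) * G.indicator (1 : Traj K → ℝ) ω - Z ω)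
      (S.law ν) := hGi.sub hZi
  have hGZ2 : Integrable (fun ω => Real.log (1 / δ) * G.indicator (1 : Traj K → ℝ) ω - Z ω
      - Real.log 2) (S.law ν) := hGZ.sub (integrable_const _)
  -- This is t + 1 ≤ exp t for t = log(1/δ) 1_G - Z - log 2, with exp(log(1/δ) 1_G) ≤ 1 + (1/δ) 1_G.
  -- Integrating gives E[t] ≤ 0, the claim.
  have hpt : ∀ ω, Real.log (1 / δ) * G.indicator (1 : Traj K → ℝ) ω - Z ω - Real.log 2 + 1
      ≤ (1 + 1 / δ * G.indicator 1 ω) * Real.exp (-Z ω) / 2 := by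
    intro ω
    refine (Real.add_one_le_exp _).trans ?_
    rw [Real.exp_sub, Real.exp_log two_pos, sub_eq_add_neg, Real.exp_add]
    gcongr
    by_cases h : ω ∈ G
    · simp only [Set.indicator_of_mem h, Pi.one_apply, mul_one]
      rw [Real.exp_log (by positivity)]
      linarith
    · simp [h]
  have hfin := (integral_mono (hGZ2.add (integrable_const 1)) hRi hpt).trans hR1
  rw [integral_add' hGZ2 (integrable_const _), integral_sub hGZ (integrable_const _), integral_sub hGi hZi, integral_const_mul,
    integral_indicator_one hGm] at hfin
  simp only [integral_const, probReal_univ, one_smul] at hfin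
  linarith

end Strategy

end CHM

/-! ### Expected pulls and the transportation inequality at the strategy's stopping time. -/

namespace CHM

lemma tsum_lt_eq_toENNReal (t : ℕ∞) :
    ∑' i : ℕ, (if (i : ℕ∞) < t then (1 : ℝ≥0∞) else 0) = (t : ℝ≥0∞) := by
  induction t using ENat.recTopCoe with
  | top =>
    simp [ENNReal.tsum_const_eq_top_of_ne_zero (α := ℕ) one_ne_zero]
  | coe k =>
    rw [tsum_eq_sum (s := Finset.range k) fun i hi => by simpa using hi]
    rw [Finset.sum_congr rfl fun i hi => if_pos (by simpa using hi)]
    simp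

namespace Strategy

variable {K : ℕ} (S : Strategy K) (ν : Fin K → Measure ℝ) [∀ a, IsProbabilityMeasure (ν a)]

lemma measurableSet_hist_lt_τ (i : ℕ) : MeasurableSet[hist K i] {ω | (i : ℕ∞) < S.τ ω} :=
  S.isStoppingTime.measurableSet_gt i

/-- The expected number of pulls of the arm `a` before the strategy stops. -/
noncomputable def pulls (a : Fin K) : ℝ≥0∞ :=
  ∑' i : ℕ, S.law ν ({ω | (i : ℕ∞) < S.τ ω} ∩ {ω | (ω i).1 = a})

/-- Exactly one arm is pulled in each round, and E[τ] is the sum of the tail probabilities P(τ > i).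
-/
lemma sum_pulls : ∑ a, S.pulls ν a = ∫⁻ ω, (S.τ ω : ℝ≥0∞) ∂S.law ν := by
  have hτ : ∀ i : ℕ, MeasurableSet {ω | (i : ℕ∞) < S.τ ω} := fun i =>
    (hist K).le i _ (S.measurableSet_hist_lt_τ i)
  have hA : ∀ (i : ℕ) a, MeasurableSet {ω : Traj K | (ω i).1 = a} := fun i a =>
    measurableSet_eq_fun (by fun_prop) measurable_const
  have hsum : ∀ i : ℕ, ∑ a, S.law ν ({ω | (i : ℕ∞) < S.τ ω} ∩ {ω | (ω i).1 = a})
      = S.law ν {ω | (i : ℕ∞) < S.τ ω} := by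
    intro i
    rw [← measure_biUnion_finset (fun a _ b _ hab => Set.disjoint_left.2
      fun ω ha hb => hab (ha.2.symm.trans hb.2)) fun a _ => (hτ i).inter (hA i a)]
    congr 1
    ext ω
    simp
  unfold pulls
  rw [← Summable.tsum_finsetSum fun _ _ => ENNReal.summable]
  simp only [hsum, ← tsum_lt_eq_toENNReal]
  rw [lintegral_tsum fun i => (Measurable.ite (hτ i) measurable_const measurable_const).aemeasurable]
  refine tsum_congr fun i => ?_
  rw [← lintegral_indicator_one (hτ i)]
  simp only [Set.indicator_apply, Set.mem_ofPred_eq, Pi.one_apply]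

lemma measurableSet_hist_decision (b : Bool) (k : ℕ) :
    MeasurableSet[hist K k] ({ω | S.decision ω = b} ∩ {ω | S.τ ω = k}) :=
  (S.isStoppingTime.measurableSet_inter_eq_iff _ k).1 <|
    (S.measurable_decision (measurableSet_singleton b)).inter
      (S.isStoppingTime.measurableSet_eq' k)

lemma measurableSet_decision (b : Bool) : MeasurableSet {ω | S.decision ω = b} :=
  S.isStoppingTime.measurableSpace_le _ (S.measurable_decision (measurableSet_singleton b))

/-- The transportation inequality at time `n`. -/
lemma log_mul_sub_le_sum_min {ν' : Fin K → Measure ℝ} [∀ a, IsProbabilityMeasure (ν' a)]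
    {φ : Fin K → ℝ → ℝ} (hφ : ∀ a, Measurable (φ a)) (hφi : ∀ a, Integrable (φ a) (ν a))
    (hν : ∀ a, ν' a = (ν a).withDensity fun x => ENNReal.ofReal (Real.exp (-φ a x)))
    (b : Bool) {δ : ℝ} (hδ : 0 < δ) (hQ : S.law ν' {ω | S.decision ω = b} ≤ ENNReal.ofReal δ)
    (n : ℕ) :
    Real.log (1 / δ) * (S.law ν).real ({ω | S.decision ω = b} ∩ {ω | S.τ ω ≤ n}) - Real.log 2
      ≤ ∑ a, (∑ i ∈ Finset.range n, (S.law ν).real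
        ({ω | (i : ℕ∞) < min (S.τ ω) n} ∩ {ω | (ω i).1 = a})) * ∫ x, φ a x ∂ν a := by
  -- Change of measure and Wald's identity are at hand for bounded times, so τ is cut off at n. The
  -- event is restricted to τ ≤ n, where the decision is known at the cut-off time.
  set σ : Traj K → ℕ := fun ω => (min (S.τ ω) n).toNat with hσ
  have hcoe : ∀ ω, (σ ω : ℕ∞) = min (S.τ ω) n := fun ω =>
    ENat.natCast_toNat (ne_top_of_le_ne_top (ENat.natCast_ne_top n) (min_le_right _ _))
  have hσn : ∀ ω, σ ω ≤ n := fun ω => by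
    have := min_le_right (S.τ ω) (n : ℕ∞)
    rw [← hcoe] at this
    exact_mod_cast this
  have heq : ∀ k, k < n → ∀ ω, σ ω = k ↔ S.τ ω = k := by
    intro k hk ω
    rw [← Nat.cast_inj (R := ℕ∞), hcoe, min_eq_iff]
    constructor
    · rintro (⟨h, _⟩ | ⟨h, _⟩)
      · exact h
      · exact absurd (by exact_mod_cast h) hk.ne'
    · intro h
      exact Or.inl ⟨h, by rw [h]; exact_mod_cast hk.le⟩
  have hσm : ∀ k, MeasurableSet[hist K k] {ω | σ ω = k} := by
    intro k
    rcases lt_trichotomy k n with hk | rfl | hk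
    · simp only [heq k hk]
      exact S.isStoppingTime.measurableSet_eq k
    -- At the cut-off itself the event only says that the strategy has not stopped earlier.
    · have : {ω | σ ω = k} = {ω | (k : ℕ∞) ≤ S.τ ω} := by
        ext ω
        rw [Set.mem_ofPred_eq, Set.mem_ofPred_eq, ← Nat.cast_inj (R := ℕ∞), hcoe, min_eq_right_iff]
      rw [this]
      exact S.isStoppingTime.measurableSet_ge k
    · have : {ω | σ ω = k} = ∅ := by
        ext ω
        have := hσn ω
        simp only [Set.mem_ofPred_eq, Set.mem_empty_iff_false, iff_false]
        lia
      rw [this]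
      exact @MeasurableSet.empty _ (hist K k)
  have hG : ∀ k, MeasurableSet[hist K k]
      (({ω | S.decision ω = b} ∩ {ω | S.τ ω ≤ n}) ∩ {ω | σ ω = k}) := by
    intro k
    rcases le_or_gt k n with hk | hk
    · have : ({ω | S.decision ω = b} ∩ {ω | S.τ ω ≤ n}) ∩ {ω | σ ω = k}
          = {ω | S.decision ω = b} ∩ {ω | S.τ ω = k} := by
        ext ω
        simp only [Set.mem_inter_iff, Set.mem_ofPred_eq, and_assoc]
        refine and_congr_right fun _ => ?_
        rw [← Nat.cast_inj (R := ℕ∞), hcoe]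
        constructor
        · rintro ⟨h1, h2⟩
          rwa [min_eq_left h1] at h2
        · intro h
          have h1 : S.τ ω ≤ n := by rw [h]; exact_mod_cast hk
          exact ⟨h1, by rwa [min_eq_left h1]⟩
      rw [this]
      exact S.measurableSet_hist_decision b k
    · have : ({ω | S.decision ω = b} ∩ {ω | S.τ ω ≤ n}) ∩ {ω | σ ω = k} = ∅ := by
        ext ω
        have := hσn ω
        simp only [Set.mem_inter_iff, Set.mem_ofPred_eq, Set.mem_empty_iff_false, iff_false]
        lia
      rw [this]
      exact @MeasurableSet.empty _ (hist K k)
  have key := S.log_mul_sub_le_sum ν hφ hφi hν hσn hσm hG hδ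
    ((measure_mono Set.inter_subset_left).trans hQ)
  simpa only [← hcoe, Nat.cast_lt] using key

/-- The transportation inequality for a strategy that stops almost surely and whose decision
separates the two bandits. -/
lemma ofReal_le_sum_pulls_mul {ν' : Fin K → Measure ℝ} [∀ a, IsProbabilityMeasure (ν' a)]
    {φ : Fin K → ℝ → ℝ} (hφ : ∀ a, Measurable (φ a)) (hφi : ∀ a, Integrable (φ a) (ν a))
    (hφ0 : ∀ a, 0 ≤ ∫ x, φ a x ∂ν a)
    (hν : ∀ a, ν' a = (ν a).withDensity fun x => ENNReal.ofReal (Real.exp (-φ a x)))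
    (b : Bool) {δ : ℝ} (hδ : 0 < δ) (hδ1 : δ < 1) (hfinite : ∀ᵐ ω ∂S.law ν, S.τ ω ≠ ⊤)
    (hP : ENNReal.ofReal (1 - δ) ≤ S.law ν {ω | S.decision ω = b})
    (hQ : S.law ν' {ω | S.decision ω = b} ≤ ENNReal.ofReal δ) :
    ENNReal.ofReal ((1 - δ) * Real.log (1 / δ) - Real.log 2)
      ≤ ∑ a, S.pulls ν a * ENNReal.ofReal (∫ x, φ a x ∂ν a) := by
  have hn : ∀ n : ℕ, ENNReal.ofReal (Real.log (1 / δ)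
      * (S.law ν).real ({ω | S.decision ω = b} ∩ {ω | S.τ ω ≤ n}) - Real.log 2)
      ≤ ∑ a, S.pulls ν a * ENNReal.ofReal (∫ x, φ a x ∂ν a) := by
    intro n
    -- The integrals of `φ` are nonnegative, so counting all pulls instead of those before n only
    -- enlarges the right-hand side.
    refine (ENNReal.ofReal_le_ofReal (S.log_mul_sub_le_sum_min ν hφ hφi hν b hδ hQ n)).trans ?_
    rw [ENNReal.ofReal_sum_of_nonneg fun a _ => mul_nonneg
      (Finset.sum_nonneg fun _ _ => measureReal_nonneg) (hφ0 a)]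
    refine Finset.sum_le_sum fun a _ => ?_
    rw [ENNReal.ofReal_mul (Finset.sum_nonneg fun _ _ => measureReal_nonneg),
      ENNReal.ofReal_sum_of_nonneg fun _ _ => measureReal_nonneg]
    gcongr
    simp only [ofReal_measureReal (measure_ne_top _ _)]
    refine le_trans (Finset.sum_le_sum fun i _ => measure_mono ?_) (ENNReal.sum_le_tsum _)
    exact Set.inter_subset_inter_left _ fun ω hω => (lt_min_iff.1 (Set.mem_ofPred_eq.mp hω)).1
  have hmono : Monotone fun n : ℕ => {ω | S.decision ω = b} ∩ {ω | S.τ ω ≤ n} :=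
    fun m n hmn => Set.inter_subset_inter_right _ fun ω hω =>
      le_trans (b := (m : ℕ∞)) hω (by exact_mod_cast hmn)
  have hlim := tendsto_measure_iUnion_atTop (μ := S.law ν) hmono
  -- Almost sure stopping under `ν` is used here: no part of the decision event is lost as n → ∞.
  have hunion : S.law ν (⋃ n : ℕ, {ω | S.decision ω = b} ∩ {ω | S.τ ω ≤ n})
      = S.law ν {ω | S.decision ω = b} := by
    refine measure_congr ?_
    filter_upwards [hfinite] with ω hω
    refine propext ?_
    change ω ∈ (⋃ n : ℕ, {ω | S.decision ω = b} ∩ {ω | S.τ ω ≤ n}) ↔ ω ∈ {ω | S.decision ω = b}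
    simp only [Set.mem_iUnion, Set.mem_inter_iff, Set.mem_ofPred_eq, exists_and_left,
      and_iff_left_iff_imp]
    obtain ⟨k, hk⟩ := ENat.ne_top_iff_exists.1 hω
    exact fun _ => ⟨k, hk.ge⟩
  rw [hunion] at hlim
  have hlim' := (((ENNReal.tendsto_toReal (measure_ne_top _ _)).comp hlim).const_mul
    (Real.log (1 / δ))).sub_const (Real.log 2)
  refine le_trans (ENNReal.ofReal_le_ofReal ?_)
    (le_of_tendsto' (ENNReal.tendsto_ofReal hlim') hn)
  rw [mul_comm]
  have hlog : 0 ≤ Real.log (1 / δ) := Real.log_nonneg (by rw [le_div_iff₀ hδ]; linarith)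
  gcongr
  exact (ENNReal.ofReal_le_iff_le_toReal (measure_ne_top _ _)).1 hP

end Strategy

/-! ### The lower bound for δ-correct strategies and its limit. -/

namespace ExpFamily

variable {F : ExpFamily} {K : ℕ} {γ : F.means} {μ : Fin K → F.means}

/-- The separating event is the decision that is right for `μ`. It is wrong for `lam`, and since
decisions are Boolean its probability there is at most δ. -/
lemma ofReal_le_sum_pulls_mul_d {S : Strategy K} {δ : ℝ} (hδ : 0 < δ) (hδ1 : δ < 1)
    (hS : F.IsDeltaCorrect γ δ S) (hμ : F.IsInstance γ μ) {lam : Fin K → F.means}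
    (hlam : F.IsInstance γ lam) (halt : lam ∈ F.Alt γ μ) :
    ENNReal.ofReal ((1 - δ) * Real.log (1 / δ) - Real.log 2)
      ≤ ∑ a, S.pulls (fun a => F.dist (μ a)) a * F.d (μ a) (lam a) := by
  have hd : ∀ a, F.d (μ a) (lam a)
      = ENNReal.ofReal (∫ x, logRatio (μ a) (lam a) x ∂F.dist (μ a)) := fun a => by
    rw [← toReal_d_eq_integral, ENNReal.ofReal_toReal (d_ne_top _ _)]
  simp only [hd]
  obtain ⟨hfinite, hT, hF⟩ := hS μ hμ
  obtain ⟨-, hT', hF'⟩ := hS lam hlam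
  have hcompl : ∀ b, ENNReal.ofReal (1 - δ) ≤ F.banditLaw S lam {ω | S.decision ω = !b} →
      F.banditLaw S lam {ω | S.decision ω = b} ≤ ENNReal.ofReal δ := by
    intro b hb
    have : {ω | S.decision ω = b} = {ω | S.decision ω = !b}ᶜ := by ext ω; simp
    have hp : IsProbabilityMeasure (F.banditLaw S lam) := by unfold banditLaw; infer_instance
    rw [this, prob_compl_eq_one_sub (S.measurableSet_decision _)]
    refine (tsub_le_tsub_left hb 1).trans_eq ?_
    rw [← ENNReal.ofReal_one, ← ENNReal.ofReal_sub _ (by linarith), sub_sub_cancel]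
  have main := fun b => S.ofReal_le_sum_pulls_mul (fun a => F.dist (μ a))
    (fun a => measurable_logRatio (μ a) (lam a)) (fun a => integrable_logRatio (μ a) (lam a))
    (fun a => by rw [← toReal_d_eq_integral]; positivity)
    (fun a => dist_eq_withDensity (μ a) (lam a)) b hδ hδ1 hfinite
  by_cases hf : F.Feasible γ μ
  · refine main true (hT hf) (hcompl true (hF' fun h => halt (iff_of_true h hf)))
  · refine main false (hF hf) (hcompl false (hT' ?_))
    by_contra h
    exact halt (iff_of_false h hf)

lemma tendsto_ofReal_sub_div_log :
    Tendsto (fun δ : ℝ => ENNReal.ofReal ((1 - δ) * Real.log (1 / δ) - Real.log 2)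
      / ENNReal.ofReal (Real.log (1 / δ))) (𝓝[>] 0) (𝓝 1) := by
  have hlog : Tendsto (fun δ : ℝ => Real.log (1 / δ)) (𝓝[>] 0) atTop := by
    simp only [one_div]
    exact Real.tendsto_log_atTop.comp tendsto_inv_nhdsGT_zero
  have h1 : Tendsto (fun δ : ℝ => (1 - δ) - Real.log 2 / Real.log (1 / δ)) (𝓝[>] 0) (𝓝 1) := by
    have ha : Tendsto (fun δ : ℝ => 1 - δ) (𝓝[>] 0) (𝓝 (1 - 0)) :=
      (tendsto_const_nhds.sub tendsto_id).mono_left nhdsWithin_le_nhds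
    simpa using ha.sub (hlog.const_div_atTop (Real.log 2))
  have h2 := ENNReal.tendsto_ofReal h1
  rw [ENNReal.ofReal_one] at h2
  refine h2.congr' ?_
  filter_upwards [hlog.eventually_gt_atTop 0] with δ hδ
  rw [← ENNReal.ofReal_div_of_pos hδ, sub_div, mul_div_cancel_right₀ _ hδ.ne']

lemma le_liminf_expectedTime_div {T : ℝ≥0∞} {S : ℝ → Strategy K}
    (h : ∀ δ : ℝ, 0 < δ → δ < 1 → ENNReal.ofReal ((1 - δ) * Real.log (1 / δ) - Real.log 2) * T
      ≤ F.expectedTime (S δ) μ) :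
    T ≤ liminf (fun δ : ℝ => F.expectedTime (S δ) μ / ENNReal.ofReal (Real.log (1 / δ)))
      (𝓝[>] 0) := by
  have hlim := ENNReal.Tendsto.mul_const (b := T) tendsto_ofReal_sub_div_log
    (Or.inl one_ne_zero)
  rw [one_mul] at hlim
  rw [← hlim.liminf_eq]
  refine liminf_le_liminf ?_
  filter_upwards [Ioo_mem_nhdsGT (zero_lt_one (α := ℝ))] with δ hδ
  rw [← ENNReal.mul_div_right_comm]
  gcongr
  exact h δ hδ.1 hδ.2

end ExpFamily

end CHM

theorem theorem1 (F : CHM.ExpFamily) {K : ℕ} (hK : 2 ≤ K) (γ : F.means) (μ : Fin K → F.means)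
    (hγ : ∀ a, μ a ≠ γ) (lo hi : Fin K) (hlo : ∀ a, a ≠ lo → μ lo < μ a)
    (hhi : ∀ a, a ≠ hi → μ a < μ hi) :
    (∀ S : ℝ → CHM.Strategy K,
      (∀ δ : ℝ, 0 < δ → δ < 1 → F.IsDeltaCorrect γ δ (S δ)) →
      F.charTime γ μ ≤
        liminf (fun δ : ℝ => F.expectedTime (S δ) μ / ENNReal.ofReal (Real.log (1 / δ)))
          (𝓝[>] 0)) ∧
    (F.Feasible γ μ →
      F.charTime γ μ = 1 / F.d (μ lo) γ + 1 / F.d (μ hi) γ ∧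
      ∀ w : Fin K → ℝ, F.IsOptimalWeights γ μ w ↔
        ∀ a, w a = if a = lo ∨ a = hi then
            (1 / F.d (μ a) γ / (1 / F.d (μ lo) γ + 1 / F.d (μ hi) γ)).toReal
          else 0) ∧
    (¬ F.Feasible γ μ →
      F.charTime γ μ = ∑ i, 1 / F.d (μ i) γ ∧
      ∀ w : Fin K → ℝ, F.IsOptimalWeights γ μ w ↔
        ∀ a, w a = (1 / F.d (μ a) γ / ∑ i, 1 / F.d (μ i) γ).toReal) := by
  have hK0 : NeZero K := ⟨by lia⟩
  have hμ : F.IsInstance γ μ := ⟨hγ, ⟨lo, hlo⟩, hi, hhi⟩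
  have hbound : ∀ S : ℝ → CHM.Strategy K,
      (∀ δ : ℝ, 0 < δ → δ < 1 → F.IsDeltaCorrect γ δ (S δ)) → ∀ δ : ℝ, 0 < δ → δ < 1 →
      ENNReal.ofReal ((1 - δ) * Real.log (1 / δ) - Real.log 2) * F.charTime γ μ
        ≤ F.expectedTime (S δ) μ := by
    intro S hS δ hδ hδ1
    have hsum : ∑ a, (S δ).pulls (fun a => F.dist (μ a)) a = F.expectedTime (S δ) μ :=
      (S δ).sum_pulls _
    -- An infinite expected time makes the bound trivial. Otherwise the expected pulls have finite
    -- total mass, as the passage to alternatives at the threshold requires.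
    rcases eq_or_ne (F.expectedTime (S δ) μ) ∞ with htop | htop
    · rw [htop]
      exact le_top
    have hinfo : ∀ lam ∈ F.Alt γ μ, F.IsInstance γ lam →
        ENNReal.ofReal ((1 - δ) * Real.log (1 / δ) - Real.log 2)
          ≤ ∑ a, (S δ).pulls (fun a => F.dist (μ a)) a * F.d (μ a) (lam a) :=
      fun lam halt hlam =>
        CHM.ExpFamily.ofReal_le_sum_pulls_mul_d hδ hδ1 (hS δ hδ hδ1) hμ hlam halt
    rw [← hsum] at htop ⊢
    by_cases hf : F.Feasible γ μ
    · rw [(CHM.ExpFamily.charTime_of_feasible hγ hlo hhi hf).1]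
      exact CHM.ExpFamily.mul_le_sum_of_feasible hγ hlo hhi hf htop hinfo
    · rw [(CHM.ExpFamily.charTime_of_not_feasible hγ hf hK).1]
      exact CHM.ExpFamily.mul_le_sum_of_not_feasible hγ hf hK htop hinfo
  exact ⟨fun S hS => CHM.ExpFamily.le_liminf_expectedTime_div (hbound S hS),
    fun hf => CHM.ExpFamily.charTime_of_feasible hγ hlo hhi hf,
    fun hf => CHM.ExpFamily.charTime_of_not_feasible hγ hf hK⟩
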